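/- Let $\mathcal P_8$ be the regular octahedron with edges of length $1$, with faces $F_1,\dots,F_8$ labelled so that its vertices, each named by the four faces containing it, are $\{1,4,6,7\},\{1,2,5,6\},\{1,2,3,4\},\{2,3,5,8\},\{3,4,7,8\},\{5,6,7,8\}$, and so that, viewed from outside, $F_2,F_4,F_6$ lie clockwise around $F_1$. (Thus $F_b,F_c$ are opposite iff $b+c=9$.) Faces are adjacent if they share an edge and opposite if they share no vertex. *Representations.* A point $p$ has representation $(F,G,x,y)$ if $F,G$ are adjacent faces, $p\in F$, and the isometric map of $F$ into the upper half-plane, exterior side towards the viewer, that takes the edge $F\cap G$ to the segment from $(0,0)$ to $(1,0)$, takes $p$ to $(x,y)$. *Surface distance.* A landscape $L$ is the sequence of faces along a path with at least two vertices in the dual graph of a net of $\mathcal P_8$. An orientation of $L$ is an unfolding of $L$ into the plane that is isometric on each face, has exterior sides towards the viewer, joins consecutive faces along their common edge, and places one face of $L$ in the upper half-plane with one of its edges on the segment from $(0,0)$ to $(1,0)$. The trail length $|T_L(p,q)|$ is the length of the segment joining the images of $p$ and $q$ in an orientation of $L$ if that segment is contained in the unfolded landscape (the shortest such segment if $p$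 or $q$ has several images), and $\infty$ otherwise. The surface distance is $$d_{\mathcal P_8}(p,q)=\min\{|T_L(p,q)| : L \text{ a landscape of } \mathcal P_8\}.$$ *Labellings.* A labelling is an enumeration $F_{n_1},\dots,F_{n_8}$ of the faces such that $F_{n_2},F_{n_4},F_{n_6}$ are the faces adjacent to $F_{n_1}$, in clockwise order viewed from outside, and $F_{n_b},F_{n_c}$ are opposite whenever $b+c=9$. Given a labelling, let $L_1,\dots,L_9$ be the landscapes with face sequences (writing $i$ for $F_{n_i}$) $$L_1=(1,2),\ L_2=(1,2,5),\ L_3=(1,6,5),\ L_4=(1,6,5,8),\ L_5=(1,2,3,8),$$ $$L_6=(1,4,7,8),\ L_7=(1,6,7,8),\ L_8=(1,2,5,8),\ L_9=(1,4,3,8).$$ **Claim.** Let $F\neq G$ be faces of $\mathcal P_8$ and let $p_1\in F$, $p_2\in G$ be distinct points. 1. Suppose $F,G$ are adjacent. There are a labelling with $F_{n_1}=F$, $F_{n_2}=G$ and representations $p_1=(F_{n_1},F_{n_2},x_1,y_1)$, $p_2=(F_{n_2},F_{n_1},x_2,y_2)$; and for all such, $d_{\mathcal P_8}(p_1,p_2)=|T_{L_1}(p_1,p_2)|$,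 where $$|T_{L_1}(p_1,p_2)|=\sqrt{(x_1+x_2-1)^2+(y_1+y_2)^2}.$$ 2. Suppose $F,G$ are neither adjacent nor opposite. There are a labelling with $F_{n_1}=F$, $F_{n_5}=G$ and representations $p_1=(F_{n_1},F_{n_2},x_1,y_1)$, $p_2=(F_{n_5},F_{n_6},x_2,y_2)$; and for all such, $d_{\mathcal P_8}(p_1,p_2)=\min\{|T_{L_2}(p_1,p_2)|,|T_{L_3}(p_1,p_2)|\}$, where $$|T_{L_2}(p_1,p_2)|=\sqrt{\left(\tfrac{1-x_1+\sqrt3y_1}{2}-x_2+1\right)^2+\left(\tfrac{\sqrt3-\sqrt3x_1-y_1}{2}-y_2\right)^2},$$ $$|T_{L_3}(p_1,p_2)|=\sqrt{\left(x_1-1-\tfrac{1-x_2+\sqrt3y_2}{2}\right)^2+\left(y_1-\tfrac{\sqrt3-\sqrt3x_2-y_2}{2}\right)^2}.$$ 3. Suppose $F,G$ are opposite. There are a labelling with $F_{n_1}=F$, $F_{n_8}=G$ and representations $p_1=(F_{n_1},F_{n_2},x_1,y_1)$, $p_2=(F_{n_8},F_{n_7},x_2,y_2)$; and for all such, $d_{\mathcal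 P_8}(p_1,p_2)=\min\{|T_{L_a}(p_1,p_2)|:4\le a\le 9\}$, where $$|T_{L_4}(p_1,p_2)|=\sqrt{\left(\tfrac{2-x_1-\sqrt3y_1}{2}-\tfrac{-2+x_2+\sqrt3y_2}{2}\right)^2+\left(\tfrac{\sqrt3x_1-y_1}{2}-\tfrac{2\sqrt3-\sqrt3x_2+y_2}{2}\right)^2},$$ $$|T_{L_5}(p_1,p_2)|=\sqrt{\left(\tfrac{1-x_1+\sqrt3y_1}{2}+x_2\right)^2+\left(\tfrac{\sqrt3-\sqrt3x_1-y_1}{2}+y_2-\sqrt3\right)^2},$$ $$|T_{L_6}(p_1,p_2)|=\sqrt{\left(x_1-\tfrac{-1+x_2-\sqrt3y_2}{2}\right)^2+\left(y_1-\tfrac{\sqrt3x_2+y_2+\sqrt3}{2}\right)^2},$$ $$|T_{L_7}(p_1,p_2)|=\sqrt{\left(x_1-\tfrac{2+x_2+\sqrt3y_2}{2}\right)^2+\left(y_1-\tfrac{-\sqrt3x_2+y_2+2\sqrt3}{2}\right)^2},$$ $$|T_{L_8}(p_1,p_2)|=\sqrt{\left(\tfrac{2-x_1-\sqrt3y_1}{2}+x_2-2\right)^2+\left(\tfrac{\sqrt3x_1-y_1}{2}+y_2-\sqrt3\right)^2},$$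 $$|T_{L_9}(p_1,p_2)|=\sqrt{\left(\tfrac{1-x_1+\sqrt3y_1}{2}-\tfrac{3+x_2-\sqrt3y_2}{2}\right)^2+\left(\tfrac{\sqrt3-\sqrt3x_1-y_1}{2}-\tfrac{\sqrt3+\sqrt3x_2+y_2}{2}\right)^2}.$$ -/

import Mathlib

noncomputable section

namespace Octahedron

/-- Euclidean three-space. -/
abbrev E3 := EuclideanSpace ℝ (Fin 3)

/-- The Euclidean plane. -/
abbrev E2 := EuclideanSpace ℝ (Fin 2)

/-! ### The unit octahedron with labelled faces -/

/-- The labels of the eight faces. -/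
inductive Face
  | F1 | F2 | F3 | F4 | F5 | F6 | F7 | F8
  deriving DecidableEq

instance : Fintype Face where
  elems := {.F1, .F2, .F3, .F4, .F5, .F6, .F7, .F8}
  complete F := by cases F <;> decide

/-- The six vertices; each is named by the four faces that contain it. -/
inductive Vertex
  | v1467 | v1256 | v1234 | v2358 | v3478 | v5678
  deriving DecidableEq

instance : Fintype Vertex where
  elems := {.v1467, .v1256, .v1234, .v2358, .v3478, .v5678}
  complete v := by cases v <;> decide

open Face Vertex

/-- The four faces incident to a vertex. -/
def Vertex.faces : Vertex → Finset Face
  | v1467 => {F1, F4, F6, F7}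
  | v1256 => {F1, F2, F5, F6}
  | v1234 => {F1, F2, F3, F4}
  | v2358 => {F2, F3, F5, F8}
  | v3478 => {F3, F4, F7, F8}
  | v5678 => {F5, F6, F7, F8}

/-- The direction of a vertex from the centre of the octahedron. -/
def Vertex.dir : Vertex → Fin 3 → ℤ
  | v1234 => ![1, 0, 0]
  | v1256 => ![0, 1, 0]
  | v1467 => ![0, 0, 1]
  | v5678 => ![-1, 0, 0]
  | v3478 => ![0, -1, 0]
  | v2358 => ![0, 0, -1]

/-- The position of a vertex. The octahedron is centred at the origin and has edges of length 1. -/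
def Vertex.pos (v : Vertex) : E3 :=
  WithLp.toLp 2 (fun i => (v.dir i : ℝ) / √2)

/-- The three vertices of a face. -/
def Face.vertices (F : Face) : Finset Vertex :=
  Finset.univ.filter (fun v => F ∈ v.faces)

/-- A face as a (closed, full) triangle in space. -/
def Face.carrier (F : Face) : Set E3 :=
  convexHull ℝ (Vertex.pos '' (F.vertices : Set Vertex))

/-- Two faces are adjacent if they share an edge, that is, exactly two vertices. -/
def faceGraph : SimpleGraph Face where
  Adj F G := F ≠ G ∧ (F.vertices ∩ G.vertices).card = 2
  symm := ⟨fun F G h => ⟨h.1.symm, by rw [Finset.inter_comm]; exact h.2⟩⟩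
  loopless := ⟨fun _ h => h.1 rfl⟩

instance : DecidableRel faceGraph.Adj :=
  fun F G => inferInstanceAs (Decidable (F ≠ G ∧ (F.vertices ∩ G.vertices).card = 2))

/-- Two faces are opposite if they have no vertex in common. -/
def Opposite (F G : Face) : Prop := Disjoint F.vertices G.vertices

/-- The vertices `a`, `b`, `c` of a face occur counterclockwise for a viewer outside the octahedron
(whose centre is the origin). -/
def CCW (a b c : Vertex) : Prop := 0 < Matrix.det (Matrix.of ![a.dir, b.dir, c.dir])

/-- The points `a`, `b`, `c` of the plane occur counterclockwise. -/
def PlanarCCW (a b c : E2) : Prop :=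
  0 < (b 0 - a 0) * (c 1 - a 1) - (b 1 - a 1) * (c 0 - a 0)

/-! ### Charts of a face and representations of points -/

/-- `g` maps the triangle `F` isometrically into the plane, with its exterior side facing the
viewer. (An isometry of a triangle into the plane is the restriction of an affine map; the values
of `g` off the plane of `F` are never used.) -/
def IsFaceMap (F : Face) (g : E3 →ᵃ[ℝ] E2) : Prop :=
  (∀ p ∈ F.carrier, ∀ q ∈ F.carrier, dist (g p) (g q) = dist p q) ∧
  ∀ a ∈ F.vertices, ∀ b ∈ F.vertices, ∀ c ∈ F.vertices,
    CCW a b c → PlanarCCW (g a.pos) (g b.pos) (g c.pos)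

/-- `g` places the triangle `F` in the upper half-plane, exterior side up, with the edge that `F`
shares with the adjacent face `G` on the segment from `(0,0)` to `(1,0)`. -/
def IsChart (F G : Face) (g : E3 →ᵃ[ℝ] E2) : Prop :=
  faceGraph.Adj F G ∧ IsFaceMap F g ∧ (∀ p ∈ F.carrier, 0 ≤ g p 1) ∧
  g '' (F.carrier ∩ G.carrier) = segment ℝ (!₂[0, 0] : E2) !₂[1, 0]

/-- The point `p` has the representation `(F, G, x, y)`: home-face `F`, shared-face `G`,
and coordinates `(x, y)`. -/
def IsRep (p : E3) (F G : Face) (x y : ℝ) : Prop :=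
  p ∈ F.carrier ∧ ∃ g : E3 →ᵃ[ℝ] E2, IsChart F G g ∧ g p = !₂[x, y]

/-! ### Landscapes, orientations, trails and the surface distance -/

/-- `N` is the dual graph of a net. A net arises by cutting the surface open along edges and
unfolding it in one piece, so its dual graph is a spanning tree of the graph of adjacent faces.
For the octahedron every such unfolding is free of overlaps, hence every spanning tree occurs. -/
def IsNetGraph (N : SimpleGraph Face) : Prop := N ≤ faceGraph ∧ N.IsTree

/-- The list `L` of faces is a landscape: a path with at least two vertices in the dual graph of
a net. -/
def IsLandscape (L : List Face) : Prop :=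
  2 ≤ L.length ∧ L.Nodup ∧ ∃ N : SimpleGraph Face, IsNetGraph N ∧ L.IsChain N.Adj

/-- `g` is the function that defines the orientation `(L, F, G)`. It unfolds the faces of `L` into
the plane, each of them isometrically and with its exterior side up, consecutive faces being joined
along their common edge, so that `F` is in the standard position relative to its edge with `G`.
It is given face by face, because a point of the octahedron that lies on several faces of `L` may
occur several times in the unfolded landscape. -/
def IsOrientation (L : List Face) (F G : Face) (g : Face → E3 →ᵃ[ℝ] E2) : Prop :=
  F ∈ L ∧ IsChart F G (g F) ∧ (∀ H ∈ L, IsFaceMap H (g H)) ∧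
  L.IsChain (fun H K => ∀ p ∈ H.carrier ∩ K.carrier, g H p = g K p)

/-- The subset of the plane covered by the unfolded landscape. -/
def unfolded (L : List Face) (g : Face → E3 →ᵃ[ℝ] E2) : Set E2 :=
  ⋃ H ∈ L, g H '' H.carrier

/-- `u` is a copy of the point `p` in the unfolded landscape. -/
def IsCopy (L : List Face) (g : Face → E3 →ᵃ[ℝ] E2) (p : E3) (u : E2) : Prop :=
  ∃ H ∈ L, p ∈ H.carrier ∧ u = g H p

open scoped ENNReal

/-- The trail length `|T_L(p, q)|`: the length of the segment between the copies of `p` and `q` in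
an orientation of `L` if this segment lies inside the unfolded landscape, and `∞` otherwise.
Orientations of `L` differ by rigid motions only, so the infimum merely selects the shortest trail
when a point has several copies. -/
def trailLength (L : List Face) (p q : E3) : ℝ≥0∞ :=
  ⨅ (F : Face) (G : Face) (g : Face → E3 →ᵃ[ℝ] E2) (_ : IsOrientation L F G g)
    (u : E2) (_ : IsCopy L g p u) (v : E2) (_ : IsCopy L g q v)
    (_ : segment ℝ u v ⊆ unfolded L g), edist u v

/-- The surface distance: the minimum of the trail lengths over the (finitely many) landscapes. -/
def surfaceDist (p q : E3) : ℝ≥0∞ :=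
  ⨅ (L : List Face) (_ : IsLandscape L), trailLength L p q

/-! ### Relabellings and the nine landscapes -/

/-- The face with label `9 - n`. -/
def Face.co : Face → Face
  | F1 => F8
  | F2 => F7
  | F3 => F6
  | F4 => F5
  | F5 => F4
  | F6 => F3
  | F7 => F2
  | F8 => F1

/-- The sum of the directions of the vertices of a face: an outward normal of that face. -/
def Face.normal (F : Face) : Fin 3 → ℤ := ∑ v ∈ F.vertices, v.dir

/-- `G`, `H`, `K` are the faces adjacent to `F`, in clockwise order around `F` for an outside
viewer. (The sum of the outward normals of these three faces is an outward normal of `F`, so the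
sense of rotation is the sign of their determinant.) -/
def ClockwiseAround (F G H K : Face) : Prop :=
  faceGraph.Adj F G ∧ faceGraph.Adj F H ∧ faceGraph.Adj F K ∧
  Matrix.det (Matrix.of ![G.normal, H.normal, K.normal]) < 0

/-- A relabelling `(F_{n_1}, …, F_{n_8})` of the faces, `ν F_i = F_{n_i}`, such that
`F_{n_2}, F_{n_4}, F_{n_6}` occur in this clockwise order around `F_{n_1}`, as `F_2, F_4, F_6` do
around `F_1`, and `F_{n_b}`, `F_{n_c}` are opposite whenever `b + c = 9`. -/
def IsLabelling (ν : Face → Face) : Prop :=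
  Function.Bijective ν ∧ (∀ i, Opposite (ν i) (ν i.co)) ∧
  ClockwiseAround (ν F1) (ν F2) (ν F4) (ν F6)

/-- The landscapes `L_1, …, L_9` as sequences of faces (and a junk value for other indices). -/
def land (ν : Face → Face) : ℕ → List Face
  | 1 => [ν F1, ν F2]
  | 2 => [ν F1, ν F2, ν F5]
  | 3 => [ν F1, ν F6, ν F5]
  | 4 => [ν F1, ν F6, ν F5, ν F8]
  | 5 => [ν F1, ν F2, ν F3, ν F8]
  | 6 => [ν F1, ν F4, ν F7, ν F8]
  | 7 => [ν F1, ν F6, ν F7, ν F8]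
  | 8 => [ν F1, ν F2, ν F5, ν F8]
  | 9 => [ν F1, ν F4, ν F3, ν F8]
  | _ => []

/-- The coordinate formulas for the trail lengths in `L_1, …, L_9` (junk for other indices). -/
def trailFormula (x₁ y₁ x₂ y₂ : ℝ) : ℕ → ℝ
  | 1 => √((x₁ + x₂ - 1) ^ 2 + (y₁ + y₂) ^ 2)
  | 2 => √(((1 - x₁ + √3 * y₁) / 2 - x₂ + 1) ^ 2 + ((√3 - √3 * x₁ - y₁) / 2 - y₂) ^ 2)
  | 3 => √((x₁ - 1 - (1 - x₂ + √3 * y₂) / 2) ^ 2 + (y₁ - (√3 - √3 * x₂ - y₂) / 2) ^ 2)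
  | 4 => √(((2 - x₁ - √3 * y₁) / 2 - (-2 + x₂ + √3 * y₂) / 2) ^ 2 +
          ((√3 * x₁ - y₁) / 2 - (2 * √3 - √3 * x₂ + y₂) / 2) ^ 2)
  | 5 => √(((1 - x₁ + √3 * y₁) / 2 + x₂) ^ 2 + ((√3 - √3 * x₁ - y₁) / 2 + y₂ - √3) ^ 2)
  | 6 => √((x₁ - (-1 + x₂ - √3 * y₂) / 2) ^ 2 + (y₁ - (√3 * x₂ + y₂ + √3) / 2) ^ 2)
  | 7 => √((x₁ - (2 + x₂ + √3 * y₂) / 2) ^ 2 + (y₁ - (-√3 * x₂ + y₂ + 2 * √3) / 2) ^ 2)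
  | 8 => √(((2 - x₁ - √3 * y₁) / 2 + x₂ - 2) ^ 2 + ((√3 * x₁ - y₁) / 2 + y₂ - √3) ^ 2)
  | 9 => √(((1 - x₁ + √3 * y₁) / 2 - (3 + x₂ - √3 * y₂) / 2) ^ 2 +
          ((√3 - √3 * x₁ - y₁) / 2 - (√3 + √3 * x₂ + y₂) / 2) ^ 2)
  | _ => 0

/-- The point `p` of `ν Fᵢ` has the representation `(ν Fᵢ, ν Fⱼ, x₁, y₁)` and the point `q` of
`ν Fₖ` has the representation `(ν Fₖ, ν Fₗ, x₂, y₂)`, for an admissible relabelling `ν` of the faces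
that takes `Fᵢ` to `F` and `Fₖ` to `G`. -/
def Normalized (p q : E3) (F G : Face) (i j k l : Face) (ν : Face → Face)
    (x₁ y₁ x₂ y₂ : ℝ) : Prop :=
  IsLabelling ν ∧ ν i = F ∧ ν k = G ∧ IsRep p (ν i) (ν j) x₁ y₁ ∧ IsRep q (ν k) (ν l) x₂ y₂

end Octahedron

end

noncomputable section

namespace Octahedron

open Face Vertex Filter Topology

/-! ### Faces as sign vectors -/

/-! A face is an octant, hence a sign vector in {1, -1}³, and crossing an edge flips one sign. A
path of faces is therefore a word in the three axes. Unfolding it means reflecting a unit triangle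
repeatedly in its sides, so all corners land in a triangular lattice. The barycentric coordinates
√2|x_i| of a surface point do not depend on the face used to compute them, and squared distances in
an unfolding are polynomials in these coordinates and in the integer squared distances of lattice
corners (`dist_sum_smul_sq`).

The candidates for the distance from F to G are the words without a repeated letter that end at G:
one word, two words or six words according to whether F and G differ in one, two or three signs. Let
`faceDist F H p x` be the minimum of the corresponding planar distances.

Lower bound: fix p. On each face H the function `faceDist F H p` is 1-Lipschitz, being a minimum of
planar distances (`faceDist_le_add`). On points common to two faces the two values agree
(`faceDist_eq_of_mem`); this reduces to a finite comparison of corner distances (`exists_word_le`).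
Now follow a segment inside any unfolded landscape. Unfoldings do not overlap, by a finite search
over face paths (`allCompatible_base`, `eq_of_unfolded_eq`), so each point of the segment names one
surface point. The function is at most 0 at p and grows at most at unit speed, whence
`faceDist_le_dist`. No classification of landscapes or shortest paths is needed.

Upper bound: the unfolding along a word without repetitions is a rhombus, a trapezoid or a
parallelogram. It is convex, so the segment stays inside and every candidate is a trail length
(`segment_subset_unfolded`, `trailLength_facePath`). Its face path extends to a spanning tree, hence
is a landscape. The two bounds give `surfaceDist_eq`.

A labelling amounts to an orientation-compatible ordering of the axes
(`IsLabelling.exists_isFraming`), and a chart is unique (`IsChart.apply_eq`), so the coordinate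
formulas become polynomial identities in barycentric coordinates. -/

/-- The coordinate axis that contains a vertex. -/
def Vertex.axis : Vertex → Fin 3
  | v1234 => 0
  | v5678 => 0
  | v1256 => 1
  | v3478 => 1
  | v1467 => 2
  | v2358 => 2

/-- The vertex of a face on a coordinate axis. -/
def Face.vtx : Face → Fin 3 → Vertex
  | F1 => ![v1234, v1256, v1467]
  | F2 => ![v1234, v1256, v2358]
  | F3 => ![v1234, v3478, v2358]
  | F4 => ![v1234, v3478, v1467]
  | F5 => ![v5678, v1256, v2358]
  | F6 => ![v5678, v1256, v1467]
  | F7 => ![v5678, v3478, v1467]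
  | F8 => ![v5678, v3478, v2358]

/-- The signs of the coordinates on a face. -/
def Face.sgn : Face → Fin 3 → ℤ
  | F1 => ![1, 1, 1]
  | F2 => ![1, 1, -1]
  | F3 => ![1, -1, -1]
  | F4 => ![1, -1, 1]
  | F5 => ![-1, 1, -1]
  | F6 => ![-1, 1, 1]
  | F7 => ![-1, -1, 1]
  | F8 => ![-1, -1, -1]

/-- The face adjacent to a face that differs in the vertex on a given axis. -/
def Face.flip : Face → Fin 3 → Face
  | F1 => ![F6, F4, F2]
  | F2 => ![F5, F3, F1]
  | F3 => ![F8, F2, F4]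
  | F4 => ![F7, F1, F3]
  | F5 => ![F2, F8, F6]
  | F6 => ![F1, F7, F5]
  | F7 => ![F4, F6, F8]
  | F8 => ![F3, F5, F7]

/-- The dual graph is the graph of the cube: sharing two vertices means differing in exactly one
sign. -/
theorem adj_iff_flip (F G : Face) : faceGraph.Adj F G ↔ ∃ i, G = F.flip i := by
  revert F G; decide +kernel

theorem adj_flip (F : Face) (i : Fin 3) : faceGraph.Adj F (F.flip i) :=
  (adj_iff_flip _ _).2 ⟨i, rfl⟩

theorem mem_vertices_iff (F : Face) (v : Vertex) : v ∈ F.vertices ↔ ∃ i, v = F.vtx i := by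
  revert F v; decide +kernel

theorem vtx_mem (F : Face) (i : Fin 3) : F.vtx i ∈ F.vertices :=
  (mem_vertices_iff _ _).2 ⟨i, rfl⟩

theorem axis_vtx (F : Face) (i : Fin 3) : (F.vtx i).axis = i := by
  revert F i; decide +kernel

theorem dir_vtx (F : Face) (i j : Fin 3) :
    (F.vtx i).dir j = if j = i then F.sgn i else 0 := by
  revert F i j; decide +kernel

theorem sgn_flip (F : Face) (i j : Fin 3) :
    (F.flip i).sgn j = if j = i then - F.sgn j else F.sgn j := by
  revert F i j; decide +kernel

theorem vtx_eq_iff_sgn (F G : Face) (i : Fin 3) : F.vtx i = G.vtx i ↔ F.sgn i = G.sgn i := by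
  revert F G i; decide +kernel

theorem vtx_flip_of_ne (F : Face) {i j : Fin 3} (h : j ≠ i) : (F.flip i).vtx j = F.vtx j := by
  rw [vtx_eq_iff_sgn, sgn_flip, if_neg h]

theorem sgn_sq (F : Face) (i : Fin 3) : F.sgn i * F.sgn i = 1 := by
  revert F i; decide +kernel

theorem sgn_eq_or (F : Face) (i : Fin 3) : F.sgn i = 1 ∨ F.sgn i = -1 := by
  revert F i; decide +kernel

/-- The orientation of the vertices of a face, taken in the order of the axes. -/
def Face.chir (F : Face) : ℤ := F.sgn 0 * F.sgn 1 * F.sgn 2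

theorem chir_flip (F : Face) (i : Fin 3) : (F.flip i).chir = - F.chir := by
  revert F i; decide +kernel

theorem chir_eq_or (F : Face) : F.chir = 1 ∨ F.chir = -1 := by
  revert F; decide +kernel

/-- The sign of three indices as a permutation; zero if two of them are equal. -/
def permSign (i j k : Fin 3) : ℤ :=
  Matrix.det (Matrix.of ![(Pi.single i 1 : Fin 3 → ℤ), Pi.single j 1, Pi.single k 1])

/-- The directions of the corners are signed unit vectors, so for distinct axes their determinant is
the sign of the order of the axes times the product of the three signs of the face. -/
theorem ccw_vtx_iff (F : Face) (i j k : Fin 3) :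
    CCW (F.vtx i) (F.vtx j) (F.vtx k) ↔ 0 < F.chir * permSign i j k := by
  unfold CCW permSign
  simp only [Matrix.det_fin_three]
  revert F i j k; decide +kernel

/-! ### Developing a sequence of faces in the triangular lattice -/

/-- The squared length of a vector of the triangular lattice. -/
def latticeSq (z : ℤ × ℤ) : ℤ := z.1 * z.1 + z.1 * z.2 + z.2 * z.2

/-- Reflect the corner `i` of a triangle in the opposite side. -/
def reflectCorner (D : Fin 3 → ℤ × ℤ) (i : Fin 3) : Fin 3 → ℤ × ℤ :=
  Function.update D i (D (i + 1) + D (i + 2) - D i)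

/-- The lattice triangle on which the first face of a sequence is placed. -/
def baseTriangle : Fin 3 → ℤ × ℤ := ![(0, 0), (1, 0), (0, 1)]

/-- The faces that are visited when one starts at `F` and crosses edges as prescribed by a word in
the axes, each with the position of its corners. -/
def develop : Face → (Fin 3 → ℤ × ℤ) → List (Fin 3) → List (Face × (Fin 3 → ℤ × ℤ))
  | F, D, [] => [(F, D)]
  | F, D, i :: m => (F, D) :: develop (F.flip i) (reflectCorner D i) m

/-- Corners of two placed faces that have the same position are the same vertex. -/
def Compatible (a b : Face × (Fin 3 → ℤ × ℤ)) : Prop :=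
  ∀ i j, a.2 i = b.2 j → a.1.vtx i = b.1.vtx j

instance (a b : Face × (Fin 3 → ℤ × ℤ)) : Decidable (Compatible a b) :=
  inferInstanceAs (Decidable (∀ i j, a.2 i = b.2 j → a.1.vtx i = b.1.vtx j))

theorem Compatible.symm {a b : Face × (Fin 3 → ℤ × ℤ)} (h : Compatible a b) : Compatible b a :=
  fun i j e => (h j i e.symm).symm

/-- Depth-first search over all continuations of a sequence of placed faces. -/
def allCompatible : ℕ → List (Face × (Fin 3 → ℤ × ℤ)) → Face × (Fin 3 → ℤ × ℤ) → Bool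
  | 0, vis, a => (a :: vis).all fun b => decide (Compatible a b)
  | n + 1, vis, a => ((a :: vis).all fun b => decide (Compatible a b)) &&
      decide (∀ i : Fin 3, a.1.flip i ∈ vis.map Prod.fst ∨
        allCompatible n (a :: vis) (a.1.flip i, reflectCorner a.2 i) = true)

-- The finite search behind the absence of overlaps in unfoldings. Depth 7 suffices because a path
-- of distinct faces makes at most seven steps.
set_option maxRecDepth 100000 in
theorem allCompatible_base (F : Face) : allCompatible 7 [] (F, baseTriangle) = true := by
  revert F; decide +kernel

theorem mem_develop_self (F : Face) (D : Fin 3 → ℤ × ℤ) (m : List (Fin 3)) :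
    (F, D) ∈ develop F D m := by
  cases m <;> simp [develop]

theorem allCompatible_head {n : ℕ} {vis : List (Face × (Fin 3 → ℤ × ℤ))}
    {a : Face × (Fin 3 → ℤ × ℤ)} (h : allCompatible n vis a = true) :
    ∀ b ∈ a :: vis, Compatible a b := by
  intro b hb
  cases n <;> rw [allCompatible] at h <;>
    simp only [Bool.and_eq_true, List.all_eq_true, decide_eq_true_eq] at h
  · exact h b hb
  · exact h.1 b hb

/-- The search compares each newly placed face with itself and all its predecessors, and it prunes
only continuations that revisit a face. A path of distinct faces is never pruned; symmetry of
compatibility then covers all pairs on it. -/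
theorem allCompatible_sound (n : ℕ) : ∀ (m : List (Fin 3)) (vis : List (Face × (Fin 3 → ℤ × ℤ)))
    (F : Face) (D : Fin 3 → ℤ × ℤ), allCompatible n vis (F, D) = true → m.length ≤ n →
    ((develop F D m).map Prod.fst).Nodup →
    (∀ G ∈ (develop F D m).map Prod.fst, G ∉ vis.map Prod.fst) →
    ∀ a ∈ develop F D m, ∀ b, b ∈ develop F D m ∨ b ∈ vis → Compatible a b := by
  induction n with
  | zero =>
    intro m vis F D h hm _ _ a ha b hb
    obtain rfl : m = [] := List.length_eq_zero_iff.1 (by omega)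
    simp only [develop, List.mem_singleton] at ha hb
    subst ha
    exact allCompatible_head h b (by simpa using hb)
  | succ n ih =>
    intro m vis F D h hm hnd hdisj a ha b hb
    have hhead := allCompatible_head h
    cases m with
    | nil =>
      simp only [develop, List.mem_singleton] at ha hb
      subst ha
      exact hhead b (by simpa using hb)
    | cons i m =>
      simp only [develop, List.map_cons, List.nodup_cons, List.mem_cons] at hnd hdisj ha hb
      have hnext : allCompatible n ((F, D) :: vis) (F.flip i, reflectCorner D i) = true := by
        rw [allCompatible] at h
        simp only [Bool.and_eq_true, decide_eq_true_eq] at h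
        refine (h.2 i).resolve_left (hdisj _ (Or.inr ?_))
        exact List.mem_map.2 ⟨_, mem_develop_self _ _ _, rfl⟩
      have key := ih m ((F, D) :: vis) (F.flip i) (reflectCorner D i) hnext
        (by simpa using hm) hnd.2 (by
          intro G hG hG'
          rw [List.map_cons, List.mem_cons] at hG'
          rcases hG' with rfl | hG'
          · exact hnd.1 hG
          · exact hdisj G (Or.inr hG) hG')
      rcases ha with rfl | ha
      · rcases hb with (rfl | hb) | hb
        · exact hhead _ List.mem_cons_self
        · exact (key b hb _ (Or.inr List.mem_cons_self)).symm
        · exact hhead _ (List.mem_cons_of_mem _ hb)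
      · rcases hb with (rfl | hb) | hb
        · exact key a ha _ (Or.inr List.mem_cons_self)
        · exact key a ha b (Or.inl hb)
        · exact key a ha b (Or.inr (List.mem_cons_of_mem _ hb))

theorem length_develop (m : List (Fin 3)) : ∀ (F : Face) (D : Fin 3 → ℤ × ℤ),
    (develop F D m).length = m.length + 1 := by
  induction m with
  | nil => intros; rfl
  | cons i m ih => intro F D; simp [develop, ih]

/-- The development of a sequence of distinct faces has no overlaps: corners at the same position
are the same vertex. -/
theorem compatible_of_nodup {F : Face} {m : List (Fin 3)}
    (h : ((develop F baseTriangle m).map Prod.fst).Nodup) :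
    ∀ a ∈ develop F baseTriangle m, ∀ b ∈ develop F baseTriangle m, Compatible a b := by
  have hlen : m.length ≤ 7 := by
    have h1 := h.length_le_card
    rw [List.length_map, length_develop] at h1
    have : Fintype.card Face = 8 := rfl
    omega
  intro a ha b hb
  exact allCompatible_sound 7 m [] F baseTriangle (allCompatible_base F) hlen h (by simp)
    a ha b (Or.inl hb)

/-- Placed faces are unit triangles whose corners are coloured by the axes. -/
def IsLatticeTriangle (D : Fin 3 → ℤ × ℤ) : Prop :=
  (∀ i j, i ≠ j → latticeSq (D i - D j) = 1) ∧
    ∀ i, (3 : ℤ) ∣ (D i).1 - (D i).2 - (((baseTriangle i).1 - (baseTriangle i).2))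

theorem isLatticeTriangle_base : IsLatticeTriangle baseTriangle := by
  refine ⟨by decide +kernel, by decide +kernel⟩

theorem reflectCorner_self (D : Fin 3 → ℤ × ℤ) (i : Fin 3) :
    reflectCorner D i i = D (i + 1) + D (i + 2) - D i := by
  simp [reflectCorner]

theorem reflectCorner_of_ne (D : Fin 3 → ℤ × ℤ) {i j : Fin 3} (h : j ≠ i) :
    reflectCorner D i j = D j := by
  simp [reflectCorner, h]

theorem latticeSq_neg (z : ℤ × ℤ) : latticeSq (-z) = latticeSq z := by
  simp [latticeSq]

/-- The colour of a lattice point is x - y modulo 3. The three colours of a triangle sum to 0, so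
the reflected corner has colour -2 times the old one, which is the old one modulo 3. -/
theorem IsLatticeTriangle.reflect {D : Fin 3 → ℤ × ℤ} (h : IsLatticeTriangle D) (i : Fin 3) :
    IsLatticeTriangle (reflectCorner D i) := by
  obtain ⟨h1, h2⟩ := h
  have hnew : ∀ j, j ≠ i → latticeSq (reflectCorner D i i - D j) = 1 := by
    intro j hj
    rw [reflectCorner_self]
    have e : j = i + 1 ∨ j = i + 2 := by revert i j; decide
    rcases e with rfl | rfl
    · rw [show D (i + 1) + D (i + 2) - D i - D (i + 1) = D (i + 2) - D i by abel]
      exact h1 _ _ (by revert i; decide)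
    · rw [show D (i + 1) + D (i + 2) - D i - D (i + 2) = D (i + 1) - D i by abel]
      exact h1 _ _ (by revert i; decide)
  refine ⟨fun j k hjk => ?_, fun j => ?_⟩
  · by_cases hj : j = i
    · subst hj
      rw [reflectCorner_of_ne _ hjk.symm]; exact hnew k hjk.symm
    · by_cases hk : k = i
      · subst hk
        rw [reflectCorner_of_ne _ hj, ← latticeSq_neg, neg_sub]; exact hnew j hj
      · rw [reflectCorner_of_ne _ hj, reflectCorner_of_ne _ hk]; exact h1 j k hjk
  · by_cases hj : j = i
    · subst hj
      rw [reflectCorner_self]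
      have a := h2 j
      have b := h2 (j + 1)
      have c := h2 (j + 2)
      simp only [Prod.fst_add, Prod.fst_sub, Prod.snd_add, Prod.snd_sub]
      fin_cases j <;> simp [baseTriangle] at a b c ⊢ <;> omega
    · rw [reflectCorner_of_ne _ hj]; exact h2 j

theorem isLatticeTriangle_develop (m : List (Fin 3)) : ∀ (F : Face) (D : Fin 3 → ℤ × ℤ),
    IsLatticeTriangle D → ∀ a ∈ develop F D m, IsLatticeTriangle a.2 := by
  induction m with
  | nil => intro F D h a ha; simp only [develop, List.mem_singleton] at ha; subst ha; exact h
  | cons i m ih =>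
    intro F D h a ha
    rw [develop, List.mem_cons] at ha
    rcases ha with rfl | ha
    · exact h
    · exact ih _ _ (h.reflect i) a ha

theorem IsLatticeTriangle.eq_of_eq {D E : Fin 3 → ℤ × ℤ} (hD : IsLatticeTriangle D)
    (hE : IsLatticeTriangle E) {i j : Fin 3} (h : D i = E j) : i = j := by
  have a := hD.2 i
  have b := hE.2 j
  rw [h] at a
  fin_cases i <;> fin_cases j <;> simp [baseTriangle] at a b ⊢ <;> omega

/-- The form a² + ab + b² is positive definite and integral. -/
theorem one_le_latticeSq {z : ℤ × ℤ} (h : z ≠ 0) : 1 ≤ latticeSq z := by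
  have h0 : z.1 ≠ 0 ∨ z.2 ≠ 0 := by
    by_contra hc
    push Not at hc
    exact h (Prod.ext hc.1 hc.2)
  have : 0 < latticeSq z := by
    unfold latticeSq
    rcases h0 with h0 | h0
    · nlinarith [sq_nonneg (z.1 + 2 * z.2), sq_pos_of_ne_zero h0 |>.le, mul_self_pos.2 h0]
    · nlinarith [sq_nonneg (2 * z.1 + z.2), mul_self_pos.2 h0]
  omega

/-- The words in the axes without repetitions. -/
def words : List (List (Fin 3)) :=
  [[], [0], [1], [2], [0, 1], [1, 0], [0, 2], [2, 0], [1, 2], [2, 1],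
    [0, 1, 2], [0, 2, 1], [1, 0, 2], [1, 2, 0], [2, 0, 1], [2, 1, 0]]

/-- The last face of a sequence of faces. -/
def endFace (F : Face) (m : List (Fin 3)) : Face := m.foldl Face.flip F

/-- The position of the last face in the development of a sequence of faces. -/
def endTriangle (m : List (Fin 3)) : Fin 3 → ℤ × ℤ := m.foldl reflectCorner baseTriangle

/-- The squared distances between the corners of the first and the last face. -/
def cornerSq (m : List (Fin 3)) (i j : Fin 3) : ℤ :=
  latticeSq (baseTriangle i - endTriangle m j)

/-- The words without repetitions that lead from one face to another. -/
def wordsTo (F G : Face) : Finset (List (Fin 3)) :=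
  (words.filter fun m => endFace F m = G).toFinset

theorem wordsTo_nonempty (F G : Face) : (wordsTo F G).Nonempty := by
  rw [wordsTo, List.toFinset_nonempty_iff]
  revert F G; decide +kernel

theorem mem_wordsTo {F G : Face} {m : List (Fin 3)} :
    m ∈ wordsTo F G ↔ m ∈ words ∧ endFace F m = G := by
  simp [wordsTo]

/-- The combinatorial core of the lower bound. Any candidate word to K can be replaced by one to H
that brings the corners shared by H and K at least as close to every corner of F. Points on both
faces have weight only on shared corners, so all their distances are controlled at once. -/
theorem exists_word_le (F H K : Face) : ∀ m' ∈ words, endFace F m' = K →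
    ∃ m ∈ words, endFace F m = H ∧
      ∀ i j, H.vtx j = K.vtx j → cornerSq m i j ≤ cornerSq m' i j := by
  revert F H K; decide +kernel

theorem endTriangle_isLatticeTriangle (m : List (Fin 3)) : IsLatticeTriangle (endTriangle m) := by
  unfold endTriangle
  generalize hD : baseTriangle = D
  have h : IsLatticeTriangle D := hD ▸ isLatticeTriangle_base
  clear hD
  induction m generalizing D with
  | nil => exact h
  | cons i m ih => exact ih _ (h.reflect i)

/-! ### Barycentric coordinates on the surface -/

/-- The barycentric coordinates of a point of the surface, indexed by the axes. -/
def bary (x : E3) (i : Fin 3) : ℝ := √2 * |x i|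

theorem bary_nonneg (x : E3) (i : Fin 3) : 0 ≤ bary x i := by
  unfold bary; positivity

theorem pos_vtx_apply (F : Face) (i j : Fin 3) :
    (F.vtx i).pos j = if j = i then (F.sgn i : ℝ) / √2 else 0 := by
  simp only [Vertex.pos, dir_vtx]
  split_ifs <;> simp

theorem sgn_mul_self_real (F : Face) (i : Fin 3) : (F.sgn i : ℝ) * F.sgn i = 1 := by
  exact_mod_cast sgn_sq F i

theorem abs_sgn (F : Face) (i : Fin 3) : |(F.sgn i : ℝ)| = 1 := by
  rcases sgn_eq_or F i with h | h <;> simp [h]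

theorem sum_smul_pos_apply (F : Face) (w : Fin 3 → ℝ) (j : Fin 3) :
    (∑ i, w i • (F.vtx i).pos) j = w j * (F.sgn j / √2) := by
  have : (∑ i, w i • (F.vtx i).pos) j = ∑ i, w i * (F.vtx i).pos j := by
    rw [WithLp.ofLp_sum, Finset.sum_apply]; rfl
  rw [this, Finset.sum_eq_single j]
  · rw [pos_vtx_apply, if_pos rfl]
  · intro i _ hi
    rw [pos_vtx_apply, if_neg hi.symm, mul_zero]
  · simp

theorem image_pos_vertices (F : Face) :
    Vertex.pos '' (F.vertices : Set Vertex) = Set.range fun i => (F.vtx i).pos := by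
  ext x
  constructor
  · rintro ⟨v, hv, rfl⟩
    obtain ⟨i, rfl⟩ := (mem_vertices_iff F v).1 (by simpa using hv)
    exact ⟨i, rfl⟩
  · rintro ⟨i, rfl⟩
    exact ⟨_, by simpa using vtx_mem F i, rfl⟩

theorem pos_vtx_mem (F : Face) (i : Fin 3) : (F.vtx i).pos ∈ F.carrier :=
  subset_convexHull ℝ _ (by rw [image_pos_vertices]; exact ⟨i, rfl⟩)

theorem sum_smul_pos_mem (F : Face) {w : Fin 3 → ℝ} (h0 : ∀ i, 0 ≤ w i) (h1 : ∑ i, w i = 1) :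
    ∑ i, w i • (F.vtx i).pos ∈ F.carrier :=
  (convex_convexHull ℝ _).sum_mem (fun i _ => h0 i) h1 fun i _ => pos_vtx_mem F i

theorem bary_sum_smul_pos (F : Face) {w : Fin 3 → ℝ} (h0 : ∀ i, 0 ≤ w i) :
    bary (∑ i, w i • (F.vtx i).pos) = w := by
  funext j
  rw [bary, sum_smul_pos_apply, abs_mul, abs_div, abs_sgn, abs_of_nonneg (h0 j),
    abs_of_pos (by positivity : (0 : ℝ) < √2)]
  field_simp

theorem exists_weights {F : Face} {x : E3} (hx : x ∈ F.carrier) :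
    ∃ w : Fin 3 → ℝ, (∀ i, 0 ≤ w i) ∧ ∑ i, w i = 1 ∧ ∑ i, w i • (F.vtx i).pos = x := by
  rw [Face.carrier, image_pos_vertices, convexHull_range_eq_exists_affineCombination] at hx
  obtain ⟨s, w, hw0, hw1, rfl⟩ := hx
  refine ⟨fun i => if i ∈ s then w i else 0, fun i => ?_, ?_, ?_⟩
  · by_cases h : i ∈ s
    · simpa [h] using hw0 i h
    · simp [h]
  · rw [Finset.sum_ite_mem, Finset.univ_inter, hw1]
  · rw [Finset.affineCombination_eq_linear_combination _ _ _ hw1]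
    simp [ite_smul, Finset.sum_ite_mem]

theorem sum_bary {F : Face} {x : E3} (hx : x ∈ F.carrier) : ∑ i, bary x i = 1 := by
  obtain ⟨w, h0, h1, rfl⟩ := exists_weights hx
  rw [bary_sum_smul_pos F h0, h1]

theorem sum_bary_smul {F : Face} {x : E3} (hx : x ∈ F.carrier) :
    ∑ i, bary x i • (F.vtx i).pos = x := by
  obtain ⟨w, h0, h1, rfl⟩ := exists_weights hx
  rw [bary_sum_smul_pos F h0]

/-- If the corners on an axis differ, the two faces lie on opposite sides of the corresponding
coordinate plane, so a common point lies in that plane. -/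
theorem bary_eq_zero {F G : Face} {x : E3} (hF : x ∈ F.carrier) (hG : x ∈ G.carrier) {i : Fin 3}
    (h : F.vtx i ≠ G.vtx i) : bary x i = 0 := by
  have a := sum_smul_pos_apply F (bary x) i
  have b := sum_smul_pos_apply G (bary x) i
  rw [sum_bary_smul hF] at a
  rw [sum_bary_smul hG, a] at b
  have hs : (F.sgn i : ℝ) - G.sgn i ≠ 0 := by
    rw [sub_ne_zero]
    exact_mod_cast fun e => h ((vtx_eq_iff_sgn _ _ _).2 e)
  have h2 : (√2 : ℝ) ≠ 0 := by positivity
  have : bary x i * ((F.sgn i : ℝ) - G.sgn i) = 0 := by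
    field_simp at b
    linear_combination b
  exact (mul_eq_zero.1 this).resolve_right hs

theorem mem_carrier_of_bary {F G : Face} {x : E3} (hF : x ∈ F.carrier)
    (h : ∀ i, F.vtx i ≠ G.vtx i → bary x i = 0) : x ∈ G.carrier := by
  have : ∑ i, bary x i • (G.vtx i).pos = x := by
    rw [← sum_bary_smul hF]
    conv_lhs => rw [sum_bary_smul hF]
    refine Finset.sum_congr rfl fun i _ => ?_
    by_cases e : F.vtx i = G.vtx i
    · rw [e]
    · rw [h i e, zero_smul, zero_smul]
  rw [← this]
  exact sum_smul_pos_mem G (bary_nonneg x) (sum_bary hF)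

theorem affine_apply {V : Type*} [AddCommGroup V] [Module ℝ V] (g : E3 →ᵃ[ℝ] V) {F : Face} {x : E3}
    (hx : x ∈ F.carrier) : g x = ∑ i, bary x i • g (F.vtx i).pos := by
  have h1 := sum_bary hx
  have hg : ∀ y, g y = g.linear y + g 0 := fun y => by
    have := g.map_vadd 0 y
    simpa using this
  rw [hg x]
  conv_lhs => rw [← sum_bary_smul hx]
  simp only [hg (Vertex.pos _), smul_add, Finset.sum_add_distrib, ← Finset.sum_smul, h1, one_smul, map_sum, map_smul]

/-! ### Distances between points of two unit triangles -/

/-- The squared distance between the points with barycentric coordinates `w` and `t` in two unit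
triangles, in terms of the squared distances between the corners. -/
def mixedSq (d : Fin 3 → Fin 3 → ℝ) (w t : Fin 3 → ℝ) : ℝ :=
  ∑ i, ∑ j, w i * t j * d i j - (w 0 * w 1 + w 0 * w 2 + w 1 * w 2)
    - (t 0 * t 1 + t 0 * t 2 + t 1 * t 2)

/-- The three points are the corners of an equilateral triangle with sides of length 1. -/
def IsUnitTriangle {V : Type*} [NormedAddCommGroup V] (a : Fin 3 → V) : Prop :=
  ∀ i j, i ≠ j → dist (a i) (a j) = 1

section
variable {V : Type*} [NormedAddCommGroup V] [InnerProductSpace ℝ V]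

/-- Expansion of the squared norm by inner products. Since both weight vectors sum to 1, every inner
product can be traded for squared distances between corners, and those within one triangle equal 1.
-/
theorem dist_sum_smul_sq {a b : Fin 3 → V} (ha : IsUnitTriangle a) (hb : IsUnitTriangle b)
    {w t : Fin 3 → ℝ} (hw : ∑ i, w i = 1) (ht : ∑ i, t i = 1) :
    dist (∑ i, w i • a i) (∑ i, t i • b i) ^ 2 = mixedSq (fun i j => dist (a i) (b j) ^ 2) w t := by
  have d : ∀ x y : V, dist x y ^ 2 = inner ℝ x x - 2 * inner ℝ x y + inner ℝ y y := fun x y => by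
    rw [dist_eq_norm, ← real_inner_self_eq_norm_sq, real_inner_sub_sub_self]
  have a1 := d (a 0) (a 1)
  have a2 := d (a 0) (a 2)
  have a3 := d (a 1) (a 2)
  have b1 := d (b 0) (b 1)
  have b2 := d (b 0) (b 2)
  have b3 := d (b 1) (b 2)
  rw [ha _ _ (by decide)] at a1 a2 a3
  rw [hb _ _ (by decide)] at b1 b2 b3
  rw [mixedSq]
  simp only [d]
  simp only [Fin.sum_univ_three] at hw ht ⊢
  simp only [inner_add_left, inner_add_right, real_inner_smul_left, real_inner_smul_right]
  rw [real_inner_comm (a 0) (a 1), real_inner_comm (a 0) (a 2), real_inner_comm (a 1) (a 2),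
    real_inner_comm (b 0) (b 1), real_inner_comm (b 0) (b 2), real_inner_comm (b 1) (b 2)]
  linear_combination w 0 * w 1 * a1 + w 0 * w 2 * a2 + w 1 * w 2 * a3 + t 0 * t 1 * b1
    + t 0 * t 2 * b2 + t 1 * t 2 * b3
    + (w 0 * inner ℝ (a 0) (a 0) + w 1 * inner ℝ (a 1) (a 1) + w 2 * inner ℝ (a 2) (a 2)) * (hw - ht)
    + (t 0 * inner ℝ (b 0) (b 0) + t 1 * inner ℝ (b 1) (b 1) + t 2 * inner ℝ (b 2) (b 2)) * (ht - hw)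

theorem dist_sum_smul_self_sq {a : Fin 3 → V} (ha : IsUnitTriangle a)
    {w t : Fin 3 → ℝ} (hw : ∑ i, w i = 1) (ht : ∑ i, t i = 1) :
    dist (∑ i, w i • a i) (∑ i, t i • a i) ^ 2 = (∑ i, (w i - t i) ^ 2) / 2 := by
  rw [dist_sum_smul_sq ha ha hw ht, mixedSq]
  simp only [Fin.sum_univ_three] at hw ht ⊢
  rw [ha 0 1 (by decide), ha 0 2 (by decide), ha 1 2 (by decide), ha 1 0 (by decide),
    ha 2 0 (by decide), ha 2 1 (by decide)]
  simp only [dist_self]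
  have h0 : w 0 = 1 - w 1 - w 2 := by linarith
  have h1 : t 0 = 1 - t 1 - t 2 := by linarith
  rw [h0, h1]
  ring

/-- If two unit triangles have the property that distinct corners have distance at least 1, then
equal points have equal coordinates, which vanish for the corners that are not shared. -/
theorem eq_of_dist_sum_smul_eq_zero {a b : Fin 3 → V} (ha : IsUnitTriangle a)
    (hb : IsUnitTriangle b) {w t : Fin 3 → ℝ} (hw : ∑ i, w i = 1) (ht : ∑ i, t i = 1)
    (hw0 : ∀ i, 0 ≤ w i) (ht0 : ∀ i, 0 ≤ t i)
    (h : ∀ i j, a i ≠ b j → 1 ≤ dist (a i) (b j)) (hij : ∀ i j, a i = b j → i = j)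
    (heq : ∑ i, w i • a i = ∑ i, t i • b i) :
    w = t ∧ ∀ i, a i ≠ b i → w i = 0 := by
  classical
  have key := dist_sum_smul_sq ha hb hw ht
  rw [heq, dist_self, mixedSq] at key
  -- Corners coincide only for equal indices, so each squared distance is 0 for a shared corner and
  -- at least 1 otherwise.
  have hlow : ∑ i, ∑ j, w i * t j * (if i = j ∧ a i = b j then 0 else 1) ≤
      ∑ i, ∑ j, w i * t j * dist (a i) (b j) ^ 2 := by
    refine Finset.sum_le_sum fun i _ => Finset.sum_le_sum fun j _ =>
      mul_le_mul_of_nonneg_left ?_ (mul_nonneg (hw0 i) (ht0 j))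
    split_ifs with c
    · positivity
    · have : a i ≠ b j := fun e => c ⟨hij i j e, e⟩
      have := h i j this
      nlinarith
  simp only [Fin.sum_univ_three] at hlow key hw ht
  simp only [Fin.isValue, true_and, show (0 : Fin 3) ≠ 1 from by decide,
    show (0 : Fin 3) ≠ 2 from by decide, show (1 : Fin 3) ≠ 0 from by decide,
    show (1 : Fin 3) ≠ 2 from by decide, show (2 : Fin 3) ≠ 0 from by decide,
    show (2 : Fin 3) ≠ 1 from by decide, false_and, if_false] at hlow
  have e0 : w 0 = 1 - w 1 - w 2 := by linarith
  have f0 : t 0 = 1 - t 1 - t 2 := by linarith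
  -- Since the weights sum to 1, the pair products of w are (1 - ∑ w²) / 2, and likewise for t.
  -- Twice the lower bound for the vanishing squared distance then becomes this sum of squares.
  have main : ∑ i, (if a i = b i then (w i - t i) ^ 2 else w i ^ 2 + t i ^ 2) ≤ 0 := by
    simp only [Fin.sum_univ_three]
    have hs : ∀ i, (if a i = b i then (w i - t i) ^ 2 else w i ^ 2 + t i ^ 2) =
      w i ^ 2 + t i ^ 2 - 2 * (w i * t i) + 2 * (w i * t i * (if a i = b i then 0 else 1)) := by
      intro i; split_ifs <;> ring
    rw [hs, hs, hs]
    have : w 0 ^ 2 + w 1 ^ 2 + w 2 ^ 2 = 1 - 2 * (w 0 * w 1 + w 0 * w 2 + w 1 * w 2) := by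
      rw [e0]; ring
    have : t 0 ^ 2 + t 1 ^ 2 + t 2 ^ 2 = 1 - 2 * (t 0 * t 1 + t 0 * t 2 + t 1 * t 2) := by
      rw [f0]; ring
    have : (w 0 + w 1 + w 2) * (t 0 + t 1 + t 2) = 1 := by rw [hw, ht, mul_one]
    linarith
  have each : ∀ i, (if a i = b i then (w i - t i) ^ 2 else w i ^ 2 + t i ^ 2) = 0 := by
    have nn : ∀ i, 0 ≤ (if a i = b i then (w i - t i) ^ 2 else w i ^ 2 + t i ^ 2) := fun i => by
      split_ifs <;> positivity
    have := (Finset.sum_eq_zero_iff_of_nonneg fun i _ => nn i).1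
      (le_antisymm main (Finset.sum_nonneg fun i _ => nn i))
    exact fun i => this i (Finset.mem_univ i)
  refine ⟨funext fun i => ?_, fun i hi => ?_⟩
  · have := each i
    split_ifs at this with c
    · nlinarith
    · nlinarith [sq_nonneg (w i), sq_nonneg (t i), sq_nonneg (w i - t i), sq_nonneg (w i + t i)]
  · have := each i
    rw [if_neg hi] at this
    nlinarith [sq_nonneg (w i), sq_nonneg (t i)]

end

/-! ### Triangular lattices in the plane and the candidate distances -/

section
variable {V : Type*} [NormedAddCommGroup V] [InnerProductSpace ℝ V]

/-- The point of the triangular lattice spanned by a triangle with given coordinates. -/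
def latticeMap (c : Fin 3 → V) (z : ℤ × ℤ) : V :=
  c 0 + (z.1 : ℝ) • (c 1 - c 0) + (z.2 : ℝ) • (c 2 - c 0)

theorem latticeMap_base (c : Fin 3 → V) (i : Fin 3) : latticeMap c (baseTriangle i) = c i := by
  fin_cases i <;> simp [latticeMap, baseTriangle]

/-- Two sides of a unit triangle have inner product 1/2, so their Gram form is a² + ab + b². -/
theorem dist_latticeMap_sq {c : Fin 3 → V} (hc : IsUnitTriangle c) (z z' : ℤ × ℤ) :
    dist (latticeMap c z) (latticeMap c z') ^ 2 = latticeSq (z - z') := by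
  have e : latticeMap c z - latticeMap c z' =
      ((z.1 - z'.1 : ℤ) : ℝ) • (c 1 - c 0) + ((z.2 - z'.2 : ℤ) : ℝ) • (c 2 - c 0) := by
    simp only [latticeMap, Int.cast_sub]; module
  have h1 : inner ℝ (c 1 - c 0) (c 1 - c 0) = 1 := by
    rw [real_inner_self_eq_norm_sq, ← dist_eq_norm, hc 1 0 (by decide), one_pow]
  have h2 : inner ℝ (c 2 - c 0) (c 2 - c 0) = 1 := by
    rw [real_inner_self_eq_norm_sq, ← dist_eq_norm, hc 2 0 (by decide), one_pow]
  have h3 : inner ℝ (c 1 - c 0) (c 2 - c 0) = 1 / 2 := by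
    have := real_inner_sub_sub_self (c 1 - c 0) (c 2 - c 0)
    rw [h1, h2, sub_sub_sub_cancel_right, real_inner_self_eq_norm_sq, ← dist_eq_norm,
      hc 1 2 (by decide)] at this
    linarith
  rw [dist_eq_norm, ← real_inner_self_eq_norm_sq, e]
  simp only [inner_add_left, inner_add_right, real_inner_smul_left, real_inner_smul_right]
  rw [real_inner_comm (c 1 - c 0) (c 2 - c 0), h1, h2, h3, latticeSq]
  push_cast [Prod.fst_sub, Prod.snd_sub]
  ring

theorem latticeMap_injective {c : Fin 3 → V} (hc : IsUnitTriangle c) :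
    Function.Injective (latticeMap c) := by
  intro z z' h
  by_contra hne
  have h1 := dist_latticeMap_sq hc z z'
  have h2 := one_le_latticeSq (sub_ne_zero.2 hne)
  rw [h, dist_self] at h1
  have : latticeSq (z - z') = 0 := by exact_mod_cast (by linarith : (latticeSq (z - z') : ℝ) = 0)
  omega

theorem one_le_dist_latticeMap {c : Fin 3 → V} (hc : IsUnitTriangle c) {z z' : ℤ × ℤ}
    (h : z ≠ z') : 1 ≤ dist (latticeMap c z) (latticeMap c z') := by
  have h1 := dist_latticeMap_sq hc z z'
  have h2 : (1 : ℝ) ≤ latticeSq (z - z') := by exact_mod_cast one_le_latticeSq (sub_ne_zero.2 h)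
  rw [← h1] at h2
  nlinarith [dist_nonneg (x := latticeMap c z) (y := latticeMap c z')]

theorem IsLatticeTriangle.isUnitTriangle {c : Fin 3 → V} (hc : IsUnitTriangle c)
    {D : Fin 3 → ℤ × ℤ} (hD : IsLatticeTriangle D) : IsUnitTriangle fun i => latticeMap c (D i) := by
  intro i j hij
  have h1 := dist_latticeMap_sq hc (D i) (D j)
  rw [hD.1 i j hij] at h1
  exact (pow_eq_one_iff_of_nonneg dist_nonneg two_ne_zero).1 (by simpa using h1)

end

/-- A standard unit triangle in the plane. -/
def stdTriangle : Fin 3 → E2 := ![!₂[0, 0], !₂[1, 0], !₂[1 / 2, √3 / 2]]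

theorem isUnitTriangle_of_sq {c : Fin 3 → E2}
    (h01 : (c 0 0 - c 1 0) ^ 2 + (c 0 1 - c 1 1) ^ 2 = 1)
    (h02 : (c 0 0 - c 2 0) ^ 2 + (c 0 1 - c 2 1) ^ 2 = 1)
    (h12 : (c 1 0 - c 2 0) ^ 2 + (c 1 1 - c 2 1) ^ 2 = 1) : IsUnitTriangle c := by
  have a : dist (c 0) (c 1) = 1 := by
    rw [EuclideanSpace.dist_eq, Fin.sum_univ_two, Real.dist_eq, Real.dist_eq, sq_abs, sq_abs, h01,
      Real.sqrt_one]
  have b : dist (c 0) (c 2) = 1 := by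
    rw [EuclideanSpace.dist_eq, Fin.sum_univ_two, Real.dist_eq, Real.dist_eq, sq_abs, sq_abs, h02,
      Real.sqrt_one]
  have d : dist (c 1) (c 2) = 1 := by
    rw [EuclideanSpace.dist_eq, Fin.sum_univ_two, Real.dist_eq, Real.dist_eq, sq_abs, sq_abs, h12,
      Real.sqrt_one]
  intro i j hij
  fin_cases i <;> fin_cases j <;> first | exact absurd rfl hij | assumption | (rw [dist_comm]; assumption)

theorem sqrt_three_sq : (√3 : ℝ) ^ 2 = 3 := Real.sq_sqrt (by norm_num)

theorem isUnitTriangle_std : IsUnitTriangle stdTriangle := by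
  have := sqrt_three_sq
  apply isUnitTriangle_of_sq <;> simp [stdTriangle] <;> nlinarith

/-- The distance from `p` to `x` in the plane, along the sequence of faces given by a word, when `p`
lies in the first and `x` in the last face. -/
def wordDist (m : List (Fin 3)) (p x : E3) : ℝ :=
  dist (∑ i, bary p i • stdTriangle i)
    (∑ i, bary x i • latticeMap stdTriangle (endTriangle m i))

theorem dist_develop_sq {V : Type*} [NormedAddCommGroup V] [InnerProductSpace ℝ V]
    {c : Fin 3 → V} (hc : IsUnitTriangle c) (m : List (Fin 3))
    {F G : Face} {p x : E3} (hp : p ∈ F.carrier) (hx : x ∈ G.carrier) :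
    dist (∑ i, bary p i • c i) (∑ i, bary x i • latticeMap c (endTriangle m i)) ^ 2 =
      mixedSq (fun i j => (cornerSq m i j : ℝ)) (bary p) (bary x) := by
  rw [dist_sum_smul_sq hc ((endTriangle_isLatticeTriangle m).isUnitTriangle hc) (sum_bary hp)
    (sum_bary hx)]
  congr 1
  funext i j
  rw [← latticeMap_base c i, dist_latticeMap_sq hc, cornerSq]

theorem wordDist_sq (m : List (Fin 3)) {F G : Face} {p x : E3} (hp : p ∈ F.carrier)
    (hx : x ∈ G.carrier) :
    wordDist m p x ^ 2 = mixedSq (fun i j => (cornerSq m i j : ℝ)) (bary p) (bary x) :=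
  dist_develop_sq isUnitTriangle_std m hp hx

theorem wordDist_nonneg (m : List (Fin 3)) (p x : E3) : 0 ≤ wordDist m p x := dist_nonneg

theorem dist_develop {V : Type*} [NormedAddCommGroup V] [InnerProductSpace ℝ V]
    {c : Fin 3 → V} (hc : IsUnitTriangle c) (m : List (Fin 3))
    {F G : Face} {p x : E3} (hp : p ∈ F.carrier) (hx : x ∈ G.carrier) :
    dist (∑ i, bary p i • c i) (∑ i, bary x i • latticeMap c (endTriangle m i)) =
      wordDist m p x := by
  rw [← sq_eq_sq₀ dist_nonneg (wordDist_nonneg _ _ _), dist_develop_sq hc m hp hx,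
    wordDist_sq m hp hx]

theorem dist_sum_bary_eq {V W : Type*} [NormedAddCommGroup V] [InnerProductSpace ℝ V]
    [NormedAddCommGroup W] [InnerProductSpace ℝ W]
    {a : Fin 3 → V} (ha : IsUnitTriangle a) {b : Fin 3 → W} (hb : IsUnitTriangle b)
    {F : Face} {x y : E3} (hx : x ∈ F.carrier) (hy : y ∈ F.carrier) :
    dist (∑ i, bary x i • a i) (∑ i, bary y i • a i) =
      dist (∑ i, bary x i • b i) (∑ i, bary y i • b i) := by
  rw [← sq_eq_sq₀ dist_nonneg dist_nonneg, dist_sum_smul_self_sq ha (sum_bary hx) (sum_bary hy),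
    dist_sum_smul_self_sq hb (sum_bary hx) (sum_bary hy)]

theorem isUnitTriangle_pos (F : Face) : IsUnitTriangle fun i => (F.vtx i).pos := by
  have h2 : (√2 : ℝ) ^ 2 = 2 := Real.sq_sqrt (by norm_num)
  have key : ∀ i j, i ≠ j → dist (F.vtx i).pos (F.vtx j).pos ^ 2 = 1 := by
    intro i j hij
    rw [EuclideanSpace.dist_eq, Real.sq_sqrt (Finset.sum_nonneg fun _ _ => sq_nonneg _)]
    simp only [Real.dist_eq, sq_abs, pos_vtx_apply]
    have s := fun i => sgn_mul_self_real F i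
    have e : ∀ k, ((if k = i then (F.sgn i : ℝ) / √2 else 0) - (if k = j then (F.sgn j : ℝ) / √2 else 0)) ^ 2
        = (if k = i then 1 / 2 else 0) + (if k = j then 1 / 2 else 0) := by
      intro k
      by_cases h : k = i
      · subst h
        rw [if_pos rfl, if_neg hij, if_pos rfl, if_neg hij, sub_zero, div_pow, h2, pow_two, s, add_zero]
      · rw [if_neg h, if_neg h]
        by_cases h' : k = j
        · rw [if_pos h', if_pos h', zero_sub, neg_sq, div_pow, h2, pow_two, s, zero_add]
        · rw [if_neg h', if_neg h']; norm_num
    simp only [e, Finset.sum_add_distrib, Finset.sum_ite_eq', Finset.mem_univ, if_true]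
    norm_num
  intro i j hij
  exact (pow_eq_one_iff_of_nonneg dist_nonneg two_ne_zero).1 (key i j hij)

theorem IsFaceMap.isUnitTriangle {F : Face} {g : E3 →ᵃ[ℝ] E2} (hg : IsFaceMap F g) :
    IsUnitTriangle fun i => g (F.vtx i).pos := by
  intro i j hij
  simp only
  rw [hg.1 _ (pos_vtx_mem F i) _ (pos_vtx_mem F j)]
  exact isUnitTriangle_pos F i j hij

/-- The minimum of the candidate distances from a point `p` of `F` to a point `x` of `H`. -/
def faceDist (F H : Face) (p x : E3) : ℝ :=
  (wordsTo F H).inf' (wordsTo_nonempty F H) fun m => wordDist m p x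

/-- Take the word that is optimal for x and apply the triangle inequality in its development;
distances inside H are the same in every isometric placement of H. -/
theorem faceDist_le_add {F H : Face} {g : E3 →ᵃ[ℝ] E2} (hg : IsFaceMap H g) (p : E3) {x y : E3}
    (hx : x ∈ H.carrier) (hy : y ∈ H.carrier) :
    faceDist F H p y ≤ faceDist F H p x + dist (g x) (g y) := by
  obtain ⟨m, hm, e⟩ := Finset.exists_mem_eq_inf' (wordsTo_nonempty F H) fun m => wordDist m p x
  rw [faceDist, faceDist, e]
  refine (Finset.inf'_le _ hm).trans ?_
  rw [affine_apply g hx, affine_apply g hy, dist_sum_bary_eq hg.isUnitTriangle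
    ((endTriangle_isLatticeTriangle m).isUnitTriangle isUnitTriangle_std) hx hy]
  exact dist_triangle _ _ _

/-- The squared distance is monotone in the corner distances because the weights are nonnegative,
and corners of H that are not in K have weight 0. This makes `faceDist` depend only on the surface
point. -/
theorem faceDist_le_of_mem {F H K : Face} {p x : E3} (hp : p ∈ F.carrier) (hH : x ∈ H.carrier)
    (hK : x ∈ K.carrier) : faceDist F H p x ≤ faceDist F K p x := by
  refine Finset.le_inf' _ _ fun m' hm' => ?_
  obtain ⟨hm1, hm2⟩ := mem_wordsTo.1 hm'
  obtain ⟨m, h1, h2, h3⟩ := exists_word_le F H K m' hm1 hm2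
  refine (Finset.inf'_le _ (mem_wordsTo.2 ⟨h1, h2⟩)).trans ?_
  rw [← sq_le_sq₀ (wordDist_nonneg _ _ _) (wordDist_nonneg _ _ _), wordDist_sq m hp hH,
    wordDist_sq m' hp hH, mixedSq, mixedSq]
  have : ∑ i, ∑ j, bary p i * bary x j * (cornerSq m i j : ℝ) ≤
      ∑ i, ∑ j, bary p i * bary x j * (cornerSq m' i j : ℝ) := by
    refine Finset.sum_le_sum fun i _ => Finset.sum_le_sum fun j _ => ?_
    by_cases hj : H.vtx j = K.vtx j
    · exact mul_le_mul_of_nonneg_left (by exact_mod_cast h3 i j hj)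
        (mul_nonneg (bary_nonneg p i) (bary_nonneg x j))
    · rw [bary_eq_zero hH hK hj]; simp
  linarith

theorem faceDist_eq_of_mem {F H K : Face} {p x : E3} (hp : p ∈ F.carrier) (hH : x ∈ H.carrier)
    (hK : x ∈ K.carrier) : faceDist F H p x = faceDist F K p x :=
  le_antisymm (faceDist_le_of_mem hp hH hK) (faceDist_le_of_mem hp hK hH)

theorem faceDist_self_le (F : Face) (p : E3) : faceDist F F p p ≤ 0 := by
  refine (Finset.inf'_le _ (mem_wordsTo.2 ⟨List.mem_cons_self, rfl⟩)).trans ?_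
  simp [wordDist, endTriangle, latticeMap_base]

/-! ### Orientations of landscapes are developments -/

/-- The determinant that decides the orientation of three points of the plane. -/
def planarDet (a b c : E2) : ℝ :=
  (b 0 - a 0) * (c 1 - a 1) - (b 1 - a 1) * (c 0 - a 0)

theorem dist_sq_E2 (a b : E2) : dist a b ^ 2 = (a 0 - b 0) ^ 2 + (a 1 - b 1) ^ 2 := by
  rw [EuclideanSpace.dist_eq, Real.sq_sqrt (Finset.sum_nonneg fun _ _ => sq_nonneg _),
    Fin.sum_univ_two, Real.dist_eq, Real.dist_eq, sq_abs, sq_abs]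

/-- Only two points complete an edge to a unit triangle. Relative to the edge from a to b both have
inner product 1/2 and cross product with square 3/4; the sign condition puts c and d on different
sides. -/
theorem eq_reflection {a b c d : E2} (hab : dist a b = 1) (hac : dist a c = 1) (hbc : dist b c = 1)
    (had : dist a d = 1) (hbd : dist b d = 1) (h : planarDet a b c * planarDet a b d < 0) :
    d = a + b - c := by
  have e1 := dist_sq_E2 a b
  have e2 := dist_sq_E2 a c
  have e3 := dist_sq_E2 b c
  have e4 := dist_sq_E2 a d
  have e5 := dist_sq_E2 b d
  rw [hab] at e1; rw [hac] at e2; rw [hbc] at e3; rw [had] at e4; rw [hbd] at e5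
  unfold planarDet at h
  obtain ⟨e, he⟩ : ∃ e, e = b 0 - a 0 := ⟨_, rfl⟩
  obtain ⟨f, hf⟩ : ∃ f, f = b 1 - a 1 := ⟨_, rfl⟩
  obtain ⟨x, hx⟩ : ∃ x, x = c 0 - a 0 := ⟨_, rfl⟩
  obtain ⟨y, hy⟩ : ∃ y, y = c 1 - a 1 := ⟨_, rfl⟩
  obtain ⟨z, hz⟩ : ∃ z, z = d 0 - a 0 := ⟨_, rfl⟩
  obtain ⟨w, hw⟩ : ∃ w, w = d 1 - a 1 := ⟨_, rfl⟩
  rw [← he, ← hf, ← hx, ← hy, ← hz, ← hw] at h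
  have q1 : e ^ 2 + f ^ 2 = 1 := by rw [he, hf]; linarith
  have q2 : x ^ 2 + y ^ 2 = 1 := by rw [hx, hy]; linarith
  have q3 : (e - x) ^ 2 + (f - y) ^ 2 = 1 := by rw [he, hf, hx, hy]; linarith
  have q4 : z ^ 2 + w ^ 2 = 1 := by rw [hz, hw]; linarith
  have q5 : (e - z) ^ 2 + (f - w) ^ 2 = 1 := by rw [he, hf, hz, hw]; linarith
  have i1 : e * x + f * y = 1 / 2 := by linarith
  have i2 : e * z + f * w = 1 / 2 := by linarith
  have s1 : (e * y - f * x) ^ 2 = 3 / 4 := by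
    linear_combination (x ^ 2 + y ^ 2) * q1 + q2 - (e * x + f * y + 1 / 2) * i1
  have s2 : (e * w - f * z) ^ 2 = 3 / 4 := by
    linear_combination (z ^ 2 + w ^ 2) * q1 + q4 - (e * z + f * w + 1 / 2) * i2
  have s3 : e * w - f * z = -(e * y - f * x) := by
    have : ((e * w - f * z) - (e * y - f * x)) * ((e * w - f * z) + (e * y - f * x)) = 0 := by
      linear_combination s2 - s1
    rcases mul_eq_zero.1 this with t | t
    · have : e * w - f * z = e * y - f * x := by linarith
      rw [this] at h
      exact absurd h (mul_self_nonneg _).not_gt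
    · linarith
  -- The vector from a to c plus that from a to d has inner product 1 and cross product 0 with the
  -- unit vector (e, f), hence equals it.
  have r0 : x + z = e := by
    linear_combination e * (i1 + i2) - f * s3 - (x + z) * q1
  have r1 : y + w = f := by
    linear_combination f * (i1 + i2) + e * s3 - (y + w) * q1
  ext k
  fin_cases k
  · simp only [Fin.zero_eta, PiLp.sub_apply, PiLp.add_apply]; linarith
  · simp only [Fin.mk_one, PiLp.sub_apply, PiLp.add_apply]; linarith

theorem IsFaceMap.chir_mul_pos {F : Face} {g : E3 →ᵃ[ℝ] E2} (hg : IsFaceMap F g) (i : Fin 3) :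
    0 < F.chir * planarDet (g (F.vtx (i + 1)).pos) (g (F.vtx (i + 2)).pos) (g (F.vtx i).pos) := by
  have p1 : permSign (i + 1) (i + 2) i = 1 := by
    unfold permSign; rw [Matrix.det_fin_three]; revert i; decide +kernel
  have p2 : permSign (i + 2) (i + 1) i = -1 := by
    unfold permSign; rw [Matrix.det_fin_three]; revert i; decide +kernel
  rcases chir_eq_or F with h | h
  · have := hg.2 _ (vtx_mem F (i + 1)) _ (vtx_mem F (i + 2)) _ (vtx_mem F i)
      ((ccw_vtx_iff F _ _ _).2 (by rw [h, p1]; norm_num))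
    rw [h]
    simpa [PlanarCCW, planarDet] using this
  · have := hg.2 _ (vtx_mem F (i + 2)) _ (vtx_mem F (i + 1)) _ (vtx_mem F i)
      ((ccw_vtx_iff F _ _ _).2 (by rw [h, p2]; norm_num))
    rw [h]
    unfold PlanarCCW at this
    unfold planarDet
    push_cast
    linarith

/-- Adjacent faces have opposite chirality with respect to the order of the axes. Both are drawn
exterior side up, so their free corners lie on different sides of the common edge. -/
theorem reflect_of_isFaceMap {H : Face} {i : Fin 3} {g g' : E3 →ᵃ[ℝ] E2} (hg : IsFaceMap H g)
    (hg' : IsFaceMap (H.flip i) g')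
    (hagree : ∀ p ∈ H.carrier ∩ (H.flip i).carrier, g p = g' p) :
    g' ((H.flip i).vtx i).pos =
      g (H.vtx (i + 1)).pos + g (H.vtx (i + 2)).pos - g (H.vtx i).pos := by
  have n1 : i + 1 ≠ i := by clear hagree hg'; revert i; decide
  have n2 : i + 2 ≠ i := by clear hagree hg'; revert i; decide
  have n3 : i + 1 ≠ i + 2 := by clear hagree hg'; revert i; decide
  have sh : ∀ j, j ≠ i → g' ((H.flip i).vtx j).pos = g (H.vtx j).pos := by
    intro j hj
    rw [vtx_flip_of_ne H hj]
    refine (hagree _ ⟨pos_vtx_mem H j, ?_⟩).symm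
    rw [← vtx_flip_of_ne H hj]
    exact pos_vtx_mem _ _
  have u := hg.isUnitTriangle
  have u' := hg'.isUnitTriangle
  have c := hg.chir_mul_pos i
  have c' := hg'.chir_mul_pos i
  rw [sh _ n1, sh _ n2, chir_flip] at c'
  have u1 := u' (i + 1) i n1
  have u2 := u' (i + 2) i n2
  simp only [sh _ n1, sh _ n2] at u1 u2
  refine eq_reflection (u _ _ n3) (u _ _ n1) (u _ _ n2) u1 u2 ?_
  rcases chir_eq_or H with h | h <;> rw [h] at c c' <;> push_cast at c c' <;> nlinarith

theorem latticeMap_reflectCorner {V : Type*} [NormedAddCommGroup V] [InnerProductSpace ℝ V]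
    (c : Fin 3 → V) (D : Fin 3 → ℤ × ℤ) (i : Fin 3) :
    latticeMap c (reflectCorner D i i) =
      latticeMap c (D (i + 1)) + latticeMap c (D (i + 2)) - latticeMap c (D i) := by
  rw [reflectCorner_self]
  simp only [latticeMap, Prod.fst_add, Prod.fst_sub, Prod.snd_add, Prod.snd_sub]
  push_cast
  module

/-- Face maps that agree along common edges place the faces as in the development. -/
theorem placed_of_chain (c : Fin 3 → E2) (g : Face → E3 →ᵃ[ℝ] E2) (m : List (Fin 3)) :
    ∀ (F : Face) (D : Fin 3 → ℤ × ℤ),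
    (∀ H ∈ (develop F D m).map Prod.fst, IsFaceMap H (g H)) →
    ((develop F D m).map Prod.fst).IsChain (fun H K => ∀ p ∈ H.carrier ∩ K.carrier, g H p = g K p) →
    (∀ i, g F (F.vtx i).pos = latticeMap c (D i)) →
    ∀ a ∈ develop F D m, ∀ i, g a.1 (a.1.vtx i).pos = latticeMap c (a.2 i) := by
  induction m with
  | nil =>
    intro F D _ _ h a ha
    simp only [develop, List.mem_singleton] at ha
    subst ha; exact h
  | cons i m ih =>
    intro F D hmap hch h a ha
    rw [develop, List.mem_cons] at ha
    rw [develop, List.map_cons] at hmap hch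
    rcases ha with rfl | ha
    · exact h
    · have hmem : F.flip i ∈ (develop (F.flip i) (reflectCorner D i) m).map Prod.fst :=
        List.mem_map.2 ⟨_, mem_develop_self _ _ _, rfl⟩
      have hagree : ∀ p ∈ F.carrier ∩ (F.flip i).carrier, g F p = g (F.flip i) p := by
        cases m <;> simp only [develop, List.map_cons, List.map_nil, List.isChain_cons_cons] at hch
          <;> exact hch.1
      refine ih (F.flip i) (reflectCorner D i) (fun H hH => hmap H (List.mem_cons_of_mem _ hH))
        hch.tail (fun j => ?_) a ha
      by_cases hj : j = i
      · subst hj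
        rw [reflect_of_isFaceMap (hmap F List.mem_cons_self) (hmap _ (List.mem_cons_of_mem _ hmem))
          hagree, latticeMap_reflectCorner, h, h, h]
      · rw [reflectCorner_of_ne _ hj, ← h, vtx_flip_of_ne F hj]
        refine (hagree _ ⟨pos_vtx_mem F j, ?_⟩).symm
        rw [← vtx_flip_of_ne F hj]
        exact pos_vtx_mem _ _

theorem exists_word_of_chain (L : List Face) : ∀ (F : Face) (D : Fin 3 → ℤ × ℤ),
    (F :: L).IsChain faceGraph.Adj → ∃ m, (develop F D m).map Prod.fst = F :: L := by
  induction L with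
  | nil => exact fun F D _ => ⟨[], rfl⟩
  | cons G L ih =>
    intro F D h
    rw [List.isChain_cons_cons] at h
    obtain ⟨i, rfl⟩ := (adj_iff_flip _ _).1 h.1
    obtain ⟨m, hm⟩ := ih _ (reflectCorner D i) h.2
    exact ⟨i :: m, by rw [develop, List.map_cons, hm]⟩

/-- An unfolding of a sequence of distinct faces has no overlaps. -/
theorem eq_of_unfolded_eq {L : List Face} (hnd : L.Nodup) (hadj : L.IsChain faceGraph.Adj)
    {g : Face → E3 →ᵃ[ℝ] E2} (hmap : ∀ H ∈ L, IsFaceMap H (g H))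
    (hch : L.IsChain (fun H K => ∀ p ∈ H.carrier ∩ K.carrier, g H p = g K p))
    {H K : Face} (hH : H ∈ L) (hK : K ∈ L) {x y : E3} (hx : x ∈ H.carrier) (hy : y ∈ K.carrier)
    (h : g H x = g K y) : x = y := by
  obtain _ | ⟨F, L⟩ := L
  · simp at hH
  obtain ⟨m, hm⟩ := exists_word_of_chain L F baseTriangle hadj
  have hc := (hmap F List.mem_cons_self).isUnitTriangle
  rw [← hm] at hnd hmap hch hH hK
  have hpl := placed_of_chain _ g m F baseTriangle hmap hch
    (fun i => (latticeMap_base (fun i => g F (F.vtx i).pos) i).symm)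
  obtain ⟨a, ha, rfl⟩ := List.mem_map.1 hH
  obtain ⟨b, hb, rfl⟩ := List.mem_map.1 hK
  have la := isLatticeTriangle_develop m F _ isLatticeTriangle_base a ha
  have lb := isLatticeTriangle_develop m F _ isLatticeTriangle_base b hb
  rw [affine_apply _ hx, affine_apply _ hy] at h
  simp only [hpl a ha, hpl b hb] at h
  -- Distinct lattice points are at distance at least 1 and coinciding corners have the same colour.
  -- So x and y have equal weights, carried by corners at common positions, and these are equal
  -- vertices by compatibility.
  obtain ⟨h1, h2⟩ := eq_of_dist_sum_smul_eq_zero (la.isUnitTriangle hc) (lb.isUnitTriangle hc)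
    (sum_bary hx) (sum_bary hy) (bary_nonneg x) (bary_nonneg y)
    (fun i j hij => one_le_dist_latticeMap hc fun e => hij (by rw [e]))
    (fun i j hij => la.eq_of_eq lb (latticeMap_injective hc hij)) h
  rw [← sum_bary_smul hx, ← sum_bary_smul hy, h1]
  refine Finset.sum_congr rfl fun i _ => ?_
  by_cases e : a.2 i = b.2 i
  · rw [compatible_of_nodup hnd a ha b hb i i e]
  · rw [← h1, h2 i fun e' => e (latticeMap_injective hc e'), zero_smul, zero_smul]

/-! ### The lower bound for trail lengths -/

/-- A function on the unit interval that is Lipschitz on each member of a finite closed cover grows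
by at most its Lipschitz constant. -/
theorem le_add_of_closed_cover {ι : Type*} (s : Finset ι) (C : ι → Set ℝ)
    (hC : ∀ i ∈ s, IsClosed (C i)) (hcov : ∀ θ ∈ Set.Icc (0 : ℝ) 1, ∃ i ∈ s, θ ∈ C i)
    (φ : ℝ → ℝ) {ℓ : ℝ} (hℓ : 0 ≤ ℓ)
    (hφ : ∀ i ∈ s, ∀ θ ∈ C i ∩ Set.Icc 0 1, ∀ θ' ∈ C i ∩ Set.Icc 0 1,
      φ θ' ≤ φ θ + ℓ * |θ' - θ|) : φ 1 ≤ φ 0 + ℓ := by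
  -- Swapping the two points in the one-sided bound yields a Lipschitz estimate. Continuity is known
  -- only piecewise, so the set where the growth bound holds is shown closed piece by piece.
  have hcont : ∀ i ∈ s, ContinuousOn φ (C i ∩ Set.Icc 0 1) := fun i hi => by
    refine (LipschitzOnWith.of_dist_le_mul (K := ℓ.toNNReal) fun x hx y hy => ?_).continuousOn
    rw [Real.coe_toNNReal ℓ hℓ, Real.dist_eq, Real.dist_eq, abs_le]
    have h1 := hφ i hi x hx y hy
    have h2 := hφ i hi y hy x hx
    rw [abs_sub_comm] at h1
    constructor <;> linarith
  have hclosed : IsClosed ({θ | φ θ ≤ φ 0 + ℓ * θ} ∩ Set.Icc 0 1) := by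
    have : {θ | φ θ ≤ φ 0 + ℓ * θ} ∩ Set.Icc 0 1 =
        ⋃ i ∈ s, {θ ∈ C i ∩ Set.Icc 0 1 | φ θ ≤ φ 0 + ℓ * θ} := by
      ext θ
      simp only [Set.mem_inter_iff, Set.mem_ofPred_eq, Set.mem_iUnion, exists_prop]
      constructor
      · rintro ⟨h1, h2⟩
        obtain ⟨i, hi, h⟩ := hcov θ h2
        exact ⟨i, hi, ⟨h, h2⟩, h1⟩
      · rintro ⟨i, hi, ⟨_, h2⟩, h1⟩
        exact ⟨h1, h2⟩
    rw [this]
    refine s.finite_toSet.isClosed_biUnion fun i hi => ?_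
    exact ((hC i hi).inter isClosed_Icc).isClosed_le (hcont i hi) (by fun_prop)
  have hsub := hclosed.Icc_subset_of_forall_exists_gt (by simp) fun θ hθ y hy => by
    -- The finitely many closed pieces missing θ also miss a neighbourhood of it. Hence any nearby
    -- θ' > θ shares a piece with θ, and the bound propagates to the right.
    have hev : ∀ᶠ θ' in 𝓝 θ, ∀ i ∈ s, θ ∉ C i → θ' ∉ C i := by
      rw [Filter.eventually_all_finset]
      intro i hi
      by_cases h : θ ∈ C i
      · exact Eventually.of_forall fun _ h' => absurd h h'
      · filter_upwards [(hC i hi).isOpen_compl.mem_nhds h] with θ' h' _ using h'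
    have hlt : θ < min y 1 := lt_min hy hθ.2.2
    obtain ⟨θ', h1, h2⟩ := ((hev.filter_mono nhdsWithin_le_nhds).and
      (Ioc_mem_nhdsGT hlt)).exists
    have hI : θ' ∈ Set.Icc (0 : ℝ) 1 :=
      ⟨hθ.2.1.trans h2.1.le, h2.2.trans (min_le_right _ _)⟩
    obtain ⟨i, hi, h⟩ := hcov θ' hI
    have h' : θ ∈ C i := by
      by_contra hn
      exact h1 i hi hn h
    have key := hφ i hi θ ⟨h', hθ.2.1, hθ.2.2.le⟩ θ' ⟨h, hI⟩
    rw [abs_of_pos (sub_pos.2 h2.1)] at key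
    have h0 : φ θ ≤ φ 0 + ℓ * θ := hθ.1
    refine ⟨θ', ?_, h2.1, h2.2.trans (min_le_left _ _)⟩
    change φ θ' ≤ φ 0 + ℓ * θ'
    linarith
  have := hsub (Set.right_mem_Icc.2 zero_le_one)
  simpa using this

theorem isCompact_carrier (F : Face) : IsCompact F.carrier := by
  exact Set.Finite.isCompact_convexHull ℝ (Set.Finite.image _ (Finset.finite_toSet _))

theorem IsLandscape.isChain_adj {L : List Face} (hL : IsLandscape L) :
    L.IsChain faceGraph.Adj := by
  obtain ⟨_, _, N, hN, h⟩ := hL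
  exact h.imp fun _ _ e => hN.1 e

theorem affine_continuous (g : E3 →ᵃ[ℝ] E2) : Continuous g :=
  AffineMap.continuous_of_finiteDimensional g

/-- A trail in a landscape is at least as long as one of the candidate distances. -/
theorem faceDist_le_dist {L : List Face} (hnd : L.Nodup) (hadj : L.IsChain faceGraph.Adj)
    {g : Face → E3 →ᵃ[ℝ] E2} (hmap : ∀ H ∈ L, IsFaceMap H (g H))
    (hch : L.IsChain (fun H K => ∀ p ∈ H.carrier ∩ K.carrier, g H p = g K p))
    {F G : Face} {p q : E3} (hp : p ∈ F.carrier) (hq : q ∈ G.carrier) {u v : E2}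
    (hu : IsCopy L g p u) (hv : IsCopy L g q v) (hseg : segment ℝ u v ⊆ unfolded L g) :
    faceDist F G p q ≤ dist u v := by
  classical
  obtain ⟨H₀, hH₀, hpH, rfl⟩ := hu
  obtain ⟨H₁, hH₁, hqH, rfl⟩ := hv
  set u := g H₀ p
  set v := g H₁ q
  let γ : ℝ → E2 := fun θ => AffineMap.lineMap u v θ
  have hγ : ∀ θ ∈ Set.Icc (0 : ℝ) 1, ∃ a : Face × E3, a.1 ∈ L ∧ a.2 ∈ a.1.carrier ∧
      g a.1 a.2 = γ θ := by
    intro θ hθ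
    have : γ θ ∈ unfolded L g := hseg (by
      rw [segment_eq_image_lineMap]; exact ⟨θ, hθ, rfl⟩)
    simp only [unfolded, Set.mem_iUnion, exists_prop] at this
    obtain ⟨H, hH, x, hx, e⟩ := this
    exact ⟨(H, x), hH, hx, e⟩
  have : Nonempty (Face × E3) := ⟨(F1, 0)⟩
  choose! a ha1 ha2 ha3 using hγ
  -- The chosen face and point above γ θ are immaterial: without overlaps the point is unique, and
  -- `faceDist` does not depend on the face containing it.
  have hφ : ∀ θ ∈ Set.Icc (0 : ℝ) 1, ∀ H ∈ L, ∀ x ∈ H.carrier, g H x = γ θ →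
      faceDist F (a θ).1 p (a θ).2 = faceDist F H p x := by
    intro θ hθ H hH x hx e
    have : (a θ).2 = x := eq_of_unfolded_eq hnd hadj hmap hch (ha1 θ hθ) hH (ha2 θ hθ) hx
      ((ha3 θ hθ).trans e.symm)
    have hx' := ha2 θ hθ
    rw [this] at hx' ⊢
    exact faceDist_eq_of_mem hp hx' hx
  have main := le_add_of_closed_cover L.toFinset (fun H => γ ⁻¹' (g H '' H.carrier))
    (fun H _ => ((isCompact_carrier H).image (affine_continuous _)).isClosed.preimage
      (AffineMap.lineMap_continuous))
    (fun θ hθ => ⟨(a θ).1, List.mem_toFinset.2 (ha1 θ hθ), (a θ).2, ha2 θ hθ, ha3 θ hθ⟩)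
    (fun θ => faceDist F (a θ).1 p (a θ).2) (dist_nonneg (x := u) (y := v)) (by
      rintro H hH θ ⟨⟨x, hx, e⟩, hθ⟩ θ' ⟨⟨x', hx', e'⟩, hθ'⟩
      have hH := List.mem_toFinset.1 hH
      rw [hφ θ hθ H hH x hx e, hφ θ' hθ' H hH x' hx' e']
      refine (faceDist_le_add (hmap H hH) p hx hx').trans (le_of_eq ?_)
      rw [e, e', dist_lineMap_lineMap, Real.dist_eq, abs_sub_comm, mul_comm])
  rw [hφ 0 (by simp) H₀ hH₀ p hpH (by simp [γ, u]), hφ 1 (by simp) H₁ hH₁ q hqH (by simp [γ, v]),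
    faceDist_eq_of_mem hp hpH hp, faceDist_eq_of_mem hp hqH hq] at main
  linarith [faceDist_self_le F p]

theorem ofReal_faceDist_le_surfaceDist {F G : Face} {p q : E3} (hp : p ∈ F.carrier)
    (hq : q ∈ G.carrier) : ENNReal.ofReal (faceDist F G p q) ≤ surfaceDist p q := by
  unfold surfaceDist trailLength
  simp only [le_iInf_iff]
  intro L hL F' G' g hg u hu v hv hseg
  rw [edist_dist]
  exact ENNReal.ofReal_le_ofReal
    (faceDist_le_dist hL.2.1 hL.isChain_adj hg.2.2.1 hg.2.2.2 hp hq hu hv hseg)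

/-! ### Constructing face maps and charts -/

/-- The affine map that takes the corners of a face to given points of the plane. -/
def faceMap (F : Face) (c : Fin 3 → E2) : E3 →ᵃ[ℝ] E2 :=
  (∑ i, LinearMap.smulRight
    ((√2 * F.sgn i : ℝ) • (EuclideanSpace.proj i : E3 →L[ℝ] ℝ).toLinearMap) (c i)).toAffineMap

theorem faceMap_vtx (F : Face) (c : Fin 3 → E2) (i : Fin 3) :
    faceMap F c (F.vtx i).pos = c i := by
  have h2 : (√2 : ℝ) ≠ 0 := by positivity
  have : faceMap F c (F.vtx i).pos = ∑ j, (√2 * F.sgn j * (F.vtx i).pos j) • c j := by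
    simp [faceMap, LinearMap.sum_apply]
  rw [this, Finset.sum_eq_single i]
  · rw [pos_vtx_apply, if_pos rfl]
    have : √2 * (F.sgn i : ℝ) * (F.sgn i / √2) = 1 := by
      field_simp
      linarith [sgn_mul_self_real F i]
    rw [this, one_smul]
  · intro j _ hj
    rw [pos_vtx_apply, if_neg hj, mul_zero, zero_smul]
  · simp

theorem faceMap_apply (F : Face) (c : Fin 3 → E2) {x : E3} (hx : x ∈ F.carrier) :
    faceMap F c x = ∑ i, bary x i • c i := by
  rw [affine_apply _ hx]
  simp only [faceMap_vtx]

theorem planarDet_perm (c : Fin 3 → E2) (i j k : Fin 3) :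
    planarDet (c i) (c j) (c k) = permSign i j k * planarDet (c 0) (c 1) (c 2) := by
  unfold permSign planarDet
  rw [Matrix.det_fin_three]
  fin_cases i <;> fin_cases j <;> fin_cases k <;> simp <;> ring

theorem isFaceMap_faceMap {F : Face} {c : Fin 3 → E2} (hc : IsUnitTriangle c)
    (hdet : 0 < F.chir * planarDet (c 0) (c 1) (c 2)) : IsFaceMap F (faceMap F c) := by
  refine ⟨fun p hp q hq => ?_, fun a ha b hb d hd h => ?_⟩
  · rw [faceMap_apply F c hp, faceMap_apply F c hq, dist_sum_bary_eq hc (isUnitTriangle_pos F) hp hq,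
      sum_bary_smul hp, sum_bary_smul hq]
  · obtain ⟨i, rfl⟩ := (mem_vertices_iff F a).1 ha
    obtain ⟨j, rfl⟩ := (mem_vertices_iff F b).1 hb
    obtain ⟨k, rfl⟩ := (mem_vertices_iff F d).1 hd
    rw [faceMap_vtx, faceMap_vtx, faceMap_vtx]
    change 0 < planarDet (c i) (c j) (c k)
    rw [planarDet_perm]
    have h' := (ccw_vtx_iff F i j k).1 h
    have h'' : (0 : ℝ) < F.chir * permSign i j k := by exact_mod_cast h'
    rcases chir_eq_or F with e | e <;> rw [e] at hdet h'' <;> push_cast at hdet h'' <;> nlinarith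

/-- The corners `i`, `j`, `k` of a face occur counterclockwise. -/
def Face.Cyclic (F : Face) (i j k : Fin 3) : Prop := 0 < F.chir * permSign i j k

instance (F : Face) (i j k : Fin 3) : Decidable (F.Cyclic i j k) :=
  inferInstanceAs (Decidable (0 < F.chir * permSign i j k))

theorem Face.Cyclic.distinct {F : Face} {i j k : Fin 3} (h : F.Cyclic i j k) :
    i ≠ j ∧ i ≠ k ∧ j ≠ k := by
  unfold Face.Cyclic permSign at h
  rw [Matrix.det_fin_three] at h
  revert F i j k; decide +kernel

theorem sum_of_distinct {M : Type*} [AddCommMonoid M] (f : Fin 3 → M) {i j k : Fin 3} (hij : i ≠ j)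
    (hik : i ≠ k) (hjk : j ≠ k) : ∑ n, f n = f i + f j + f k := by
  have : (Finset.univ : Finset (Fin 3)) = {i, j, k} := by revert i j k; decide
  rw [this, Finset.sum_insert (by simp [hij, hik]), Finset.sum_pair hjk, add_assoc]

/-- The standard position of a face with apex `i` and the corner `j` at the origin. -/
def chartTriangle (i j : Fin 3) (n : Fin 3) : E2 :=
  if n = i then !₂[1 / 2, √3 / 2] else if n = j then !₂[0, 0] else !₂[1, 0]

theorem isUnitTriangle_chart {i j : Fin 3} (hij : i ≠ j) : IsUnitTriangle (chartTriangle i j) := by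
  have := sqrt_three_sq
  apply isUnitTriangle_of_sq <;> fin_cases i <;> fin_cases j <;>
    first | exact absurd rfl hij | (simp [chartTriangle] <;> nlinarith)

theorem vtx_ne_flip (F : Face) (i : Fin 3) : F.vtx i ≠ (F.flip i).vtx i := by
  revert F i; decide +kernel

theorem mem_inter_flip_iff {F : Face} {i : Fin 3} {x : E3} (hx : x ∈ F.carrier) :
    x ∈ (F.flip i).carrier ↔ bary x i = 0 := by
  have hne := vtx_ne_flip F i
  refine ⟨fun h => bary_eq_zero hx h hne, fun h => mem_carrier_of_bary hx fun j hj => ?_⟩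
  by_cases e : j = i
  · rw [e, h]
  · exact absurd (vtx_flip_of_ne F e).symm hj

theorem isChart_faceMap {F : Face} {i j k : Fin 3} (h : F.Cyclic i j k) :
    IsChart F (F.flip i) (faceMap F (chartTriangle i j)) := by
  obtain ⟨hij, hik, hjk⟩ := h.distinct
  have hi : chartTriangle i j i = !₂[1 / 2, √3 / 2] := if_pos rfl
  have hj : chartTriangle i j j = !₂[0, 0] := by simp [chartTriangle, hij.symm]
  have hk : chartTriangle i j k = !₂[1, 0] := by simp [chartTriangle, hik.symm, hjk.symm]
  have happ : ∀ p ∈ F.carrier, faceMap F (chartTriangle i j) p =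
      !₂[bary p k + bary p i / 2, √3 / 2 * bary p i] := by
    intro p hp
    rw [faceMap_apply F _ hp, sum_of_distinct _ hij hik hjk, hi, hj, hk]
    ext n
    fin_cases n <;> simp <;> ring
  have hseg : segment ℝ (!₂[0, 0] : E2) !₂[1, 0] = {u | ∃ θ ∈ Set.Icc (0 : ℝ) 1, u = !₂[θ, 0]} := by
    rw [segment_eq_image]
    ext u
    constructor
    · rintro ⟨θ, hθ, rfl⟩
      refine ⟨θ, hθ, ?_⟩
      ext n; fin_cases n <;> simp
    · rintro ⟨θ, hθ, rfl⟩
      refine ⟨θ, hθ, ?_⟩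
      ext n; fin_cases n <;> simp
  refine ⟨adj_flip F i, isFaceMap_faceMap (isUnitTriangle_chart hij) ?_, fun p hp => ?_, ?_⟩
  · have e := planarDet_perm (chartTriangle i j) i j k
    rw [hi, hj, hk] at e
    have h3 : (0 : ℝ) < √3 := by positivity
    have e' : (permSign i j k : ℝ) *
        planarDet (chartTriangle i j 0) (chartTriangle i j 1) (chartTriangle i j 2) = √3 / 2 := by
      rw [← e]; simp [planarDet]; ring
    have h' : (0 : ℝ) < F.chir * permSign i j k := by exact_mod_cast h
    rcases chir_eq_or F with c | c <;> rw [c] at h' ⊢ <;> push_cast at h' ⊢ <;> nlinarith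
  · rw [happ p hp]
    have := bary_nonneg p i
    simp only [Matrix.cons_val_one, Matrix.cons_val_fin_one]
    positivity
  · rw [hseg]
    ext u
    constructor
    · rintro ⟨x, ⟨hx, hx'⟩, rfl⟩
      have h0 := (mem_inter_flip_iff hx).1 hx'
      have h1 := sum_bary hx
      rw [sum_of_distinct _ hij hik hjk, h0] at h1
      refine ⟨bary x k, ⟨bary_nonneg x k, by linarith [bary_nonneg x j]⟩, ?_⟩
      rw [happ x hx, h0]; simp
    · rintro ⟨θ, hθ, rfl⟩
      let w : Fin 3 → ℝ := fun n => if n = i then 0 else if n = j then 1 - θ else θ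
      have hw0 : ∀ n, 0 ≤ w n := by
        intro n; simp only [w]; split_ifs <;> linarith [hθ.1, hθ.2]
      have hwi : w i = 0 := by simp [w]
      have hwj : w j = 1 - θ := by simp [w, hij.symm]
      have hwk : w k = θ := by simp [w, hik.symm, hjk.symm]
      have hw1 : ∑ n, w n = 1 := by
        rw [sum_of_distinct _ hij hik hjk, hwi, hwj, hwk]; ring
      have hx := sum_smul_pos_mem F hw0 hw1
      have hb := bary_sum_smul_pos F hw0
      refine ⟨_, ⟨hx, (mem_inter_flip_iff hx).2 (by rw [hb, hwi])⟩, ?_⟩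
      rw [happ _ hx, hb, hwi, hwk]; simp

/-- A chart is determined by its two faces. -/
theorem IsChart.apply_eq {F : Face} {i j k : Fin 3} (h : F.Cyclic i j k) {g : E3 →ᵃ[ℝ] E2}
    (hg : IsChart F (F.flip i) g) {p : E3} (hp : p ∈ F.carrier) :
    g p = !₂[bary p k + bary p i / 2, √3 / 2 * bary p i] := by
  obtain ⟨hij, hik, hjk⟩ := h.distinct
  obtain ⟨_, hmap, hup, himg⟩ := hg
  have hedge : ∀ n, n ≠ i → g (F.vtx n).pos 1 = 0 ∧ 0 ≤ g (F.vtx n).pos 0 ∧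
      g (F.vtx n).pos 0 ≤ 1 := by
    intro n hn
    have : g (F.vtx n).pos ∈ segment ℝ (!₂[0, 0] : E2) !₂[1, 0] := by
      rw [← himg]
      refine ⟨_, ⟨pos_vtx_mem F n, ?_⟩, rfl⟩
      rw [← vtx_flip_of_ne F hn]; exact pos_vtx_mem _ _
    rw [segment_eq_image] at this
    obtain ⟨θ, hθ, e⟩ := this
    rw [← e]
    refine ⟨by simp, by simpa using hθ.1, by simpa using hθ.2⟩
  have hu := hmap.isUnitTriangle
  have hccw := hmap.2 _ (vtx_mem F i) _ (vtx_mem F j) _ (vtx_mem F k) ((ccw_vtx_iff F i j k).2 h)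
  have hupi := hup _ (pos_vtx_mem F i)
  obtain ⟨j1, j2, j3⟩ := hedge j hij.symm
  obtain ⟨k1, k2, k3⟩ := hedge k hik.symm
  have d1 := dist_sq_E2 (g (F.vtx i).pos) (g (F.vtx j).pos)
  have d2 := dist_sq_E2 (g (F.vtx i).pos) (g (F.vtx k).pos)
  have d3 := dist_sq_E2 (g (F.vtx j).pos) (g (F.vtx k).pos)
  have u1 := hu i j hij
  have u2 := hu i k hik
  have u3 := hu j k hjk
  simp only at u1 u2 u3
  rw [u1] at d1; rw [u2] at d2; rw [u3] at d3
  unfold PlanarCCW at hccw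
  rw [affine_apply g hp, sum_of_distinct _ hij hik hjk]
  generalize g (F.vtx i).pos = a at *
  generalize g (F.vtx j).pos = b at *
  generalize g (F.vtx k).pos = c at *
  rw [j1] at d1 d3 hccw
  rw [k1] at d2 d3 hccw
  have hbc : (b 0 - c 0 - 1) * (b 0 - c 0 + 1) = 0 := by linear_combination -d3
  have hlt : b 0 < c 0 := by
    -- In the opposite order, the apex in the upper half-plane would make the triangle clockwise.
    by_contra hcon
    push Not at hcon
    nlinarith [mul_nonneg hupi (sub_nonneg.2 hcon)]
  have hb0 : b 0 = 0 := by
    rcases mul_eq_zero.1 hbc with t | t <;> linarith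
  have hc0 : c 0 = 1 := by
    rcases mul_eq_zero.1 hbc with t | t <;> linarith
  rw [hb0] at d1
  rw [hc0] at d2
  have ha0 : a 0 = 1 / 2 := by linarith
  have ha1 : a 1 = √3 / 2 := by
    rw [ha0] at d1
    have h3 := sqrt_three_sq
    have : (a 1 - √3 / 2) * (a 1 + √3 / 2) = 0 := by linear_combination (-1) * d1 - h3 / 4
    rcases mul_eq_zero.1 this with t | t
    · linarith
    · have : (0 : ℝ) < √3 := by positivity
      linarith
  ext n
  fin_cases n
  · simp [ha0, hb0, hc0]; ring
  · simp [ha1, j1, k1]; ring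

theorem IsRep.coords {F : Face} {i j k : Fin 3} (h : F.Cyclic i j k) {p : E3} {x y : ℝ}
    (hp : IsRep p F (F.flip i) x y) : x = bary p k + bary p i / 2 ∧ y = √3 / 2 * bary p i := by
  obtain ⟨hp, g, hg, e⟩ := hp
  rw [hg.apply_eq h hp] at e
  have e0 := congrArg (fun u : E2 => u 0) e
  have e1 := congrArg (fun u : E2 => u 1) e
  simp at e0 e1
  exact ⟨e0.symm, by linarith⟩

theorem exists_isRep {F : Face} {i j k : Fin 3} (h : F.Cyclic i j k) {p : E3}
    (hp : p ∈ F.carrier) : ∃ x y, IsRep p F (F.flip i) x y :=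
  ⟨_, _, hp, _, isChart_faceMap h, (isChart_faceMap h).apply_eq h hp⟩

/-! ### Trails along words without repetitions -/

/-- The sequence of faces given by a word in the axes. -/
def facePath (F : Face) (m : List (Fin 3)) : List Face := (develop F baseTriangle m).map Prod.fst

/-- The position of a vertex in the development along a word without repetitions. -/
def vertexPos (F : Face) (m : List (Fin 3)) (v : Vertex) : ℤ × ℤ :=
  if v ∈ F.vertices then baseTriangle v.axis else endTriangle m v.axis

/-- Each axis is flipped at most once, so a corner moves at most once: it is either a vertex of F in
its initial position or already in its final one. Every vertex thus has a single copy. -/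
theorem vertexPos_develop (F : Face) : ∀ m ∈ words, ∀ a ∈ develop F baseTriangle m, ∀ i,
    a.2 i = vertexPos F m (a.1.vtx i) := by
  revert F; decide +kernel

theorem vertexPos_end (F : Face) : ∀ m ∈ words, ∀ i,
    vertexPos F m ((endFace F m).vtx i) = endTriangle m i := by
  revert F; decide +kernel

theorem vertexPos_start (F : Face) (m : List (Fin 3)) (i : Fin 3) :
    vertexPos F m (F.vtx i) = baseTriangle i := by
  rw [vertexPos, if_pos (vtx_mem F i), axis_vtx]

/-- The orientation of a lattice triangle. -/
def latticeDet (D : Fin 3 → ℤ × ℤ) : ℤ :=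
  ((D 1).1 - (D 0).1) * ((D 2).2 - (D 0).2) - ((D 1).2 - (D 0).2) * ((D 2).1 - (D 0).1)

/-- Each step reverses both the chirality of the face and the orientation of its lattice triangle,
so every placed face keeps its exterior side up. -/
theorem chir_mul_latticeDet (F : Face) : ∀ m ∈ words, ∀ a ∈ develop F baseTriangle m,
    a.1.chir * latticeDet a.2 = F.chir := by
  revert F; decide +kernel

theorem start_mem_facePath (F : Face) (m : List (Fin 3)) : F ∈ facePath F m :=
  List.mem_map.2 ⟨_, mem_develop_self _ _ _, rfl⟩

theorem end_mem_facePath (F : Face) : ∀ m ∈ words, endFace F m ∈ facePath F m := by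
  revert F; decide +kernel

theorem facePath_nodup (F : Face) : ∀ m ∈ words, (facePath F m).Nodup := by
  revert F; decide +kernel

theorem planarDet_latticeMap (c : Fin 3 → E2) (D : Fin 3 → ℤ × ℤ) :
    planarDet (latticeMap c (D 0)) (latticeMap c (D 1)) (latticeMap c (D 2)) =
      latticeDet D * planarDet (c 0) (c 1) (c 2) := by
  simp [planarDet, latticeMap, latticeDet]
  ring

theorem isChain_develop {R : Face → Face → Prop} (hR : ∀ H i, R H (H.flip i)) (m : List (Fin 3)) :
    ∀ (F : Face) (D : Fin 3 → ℤ × ℤ), ((develop F D m).map Prod.fst).IsChain R := by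
  induction m with
  | nil => intro F D; simp [develop]
  | cons i m ih =>
    intro F D
    have h := ih (F.flip i) (reflectCorner D i)
    cases m with
    | nil => simpa [develop] using hR F i
    | cons j m =>
      simp only [develop, List.map_cons, List.isChain_cons_cons] at h ⊢
      exact ⟨hR F i, h⟩

theorem exists_isOrientation (F : Face) {m : List (Fin 3)} (hm : m ∈ words) :
    ∃ F' G' g, IsOrientation (facePath F m) F' G' g := by
  obtain ⟨j, k, h⟩ : ∃ j k, F.Cyclic 0 j k := by
    unfold Face.Cyclic permSign
    simp only [Matrix.det_fin_three]
    revert F; decide +kernel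
  have hij := h.distinct.1
  have hc := isUnitTriangle_chart hij
  let c := chartTriangle 0 j
  let g : Face → E3 →ᵃ[ℝ] E2 := fun H =>
    faceMap H fun i => latticeMap c (vertexPos F m (H.vtx i))
  have hgF : g F = faceMap F c := by
    simp only [g, vertexPos_start, latticeMap_base]
  have hchart : IsChart F (F.flip 0) (g F) := hgF ▸ isChart_faceMap h
  have hpos := hchart.2.1.chir_mul_pos 0
  simp only [hgF, faceMap_vtx] at hpos
  have hpos' : 0 < F.chir * planarDet (c 0) (c 1) (c 2) := by
    have := planarDet_perm c 1 2 0
    rw [show permSign 1 2 0 = 1 by unfold permSign; rw [Matrix.det_fin_three]; decide +kernel] at this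
    rw [show planarDet (c (0 + 1)) (c (0 + 2)) (c 0) = planarDet (c 1) (c 2) (c 0) from rfl,
      this] at hpos
    simpa using hpos
  refine ⟨F, F.flip 0, g, start_mem_facePath F m, hchart, fun H hH => ?_, ?_⟩
  · obtain ⟨a, ha, rfl⟩ := List.mem_map.1 hH
    have e : (fun i => latticeMap c (vertexPos F m (a.1.vtx i))) = fun i => latticeMap c (a.2 i) := by
      funext i; rw [vertexPos_develop F m hm a ha]
    simp only [g, e]
    refine isFaceMap_faceMap
      ((isLatticeTriangle_develop m F _ isLatticeTriangle_base a ha).isUnitTriangle hc) ?_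
    rw [planarDet_latticeMap, ← mul_assoc]
    have := chir_mul_latticeDet F m hm a ha
    rw [show (a.1.chir : ℝ) * (latticeDet a.2 : ℝ) = F.chir by exact_mod_cast this]
    exact hpos'
  · refine isChain_develop (fun H i p hp => ?_) m F baseTriangle
    simp only [g]
    rw [faceMap_apply _ _ hp.1, faceMap_apply _ _ hp.2]
    refine Finset.sum_congr rfl fun n _ => ?_
    by_cases e : n = i
    · subst e
      rw [(mem_inter_flip_iff hp.1).1 hp.2, zero_smul, zero_smul]
    · rw [vtx_flip_of_ne H e]

theorem mem_image_carrier {H : Face} {g : E3 →ᵃ[ℝ] E2} {i j k : Fin 3} (hij : i ≠ j) (hik : i ≠ k)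
    (hjk : j ≠ k) {a b c : ℝ} (ha : 0 ≤ a) (hb : 0 ≤ b) (hc : 0 ≤ c) (h1 : a + b + c = 1) {u : E2}
    (hu : u = a • g (H.vtx i).pos + b • g (H.vtx j).pos + c • g (H.vtx k).pos) :
    u ∈ g '' H.carrier := by
  let w : Fin 3 → ℝ := fun n => if n = i then a else if n = j then b else c
  have hw0 : ∀ n, 0 ≤ w n := by
    intro n; simp only [w]; split_ifs <;> assumption
  have hwi : w i = a := by simp [w]
  have hwj : w j = b := by simp [w, hij.symm]
  have hwk : w k = c := by simp [w, hik.symm, hjk.symm]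
  have hw1 : ∑ n, w n = 1 := by
    rw [sum_of_distinct _ hij hik hjk, hwi, hwj, hwk, h1]
  refine ⟨_, sum_smul_pos_mem H hw0 hw1, ?_⟩
  rw [affine_apply g (sum_smul_pos_mem H hw0 hw1), bary_sum_smul_pos H hw0,
    sum_of_distinct _ hij hik hjk, hwi, hwj, hwk, hu]

theorem latticeMap_reflectCorner_distinct (c : Fin 3 → E2) (D : Fin 3 → ℤ × ℤ) {i j k : Fin 3}
    (hij : i ≠ j) (hik : i ≠ k) (hjk : j ≠ k) :
    latticeMap c (reflectCorner D i i) =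
      latticeMap c (D j) + latticeMap c (D k) - latticeMap c (D i) := by
  rw [latticeMap_reflectCorner]
  have : (i + 1 = j ∧ i + 2 = k) ∨ (i + 1 = k ∧ i + 2 = j) := by revert i j k; decide
  rcases this with ⟨h1, h2⟩ | ⟨h1, h2⟩ <;> rw [h1, h2]
  abel

theorem words_cases : ∀ m ∈ words, m = [] ∨ (∃ i j k, i ≠ j ∧ i ≠ k ∧ j ≠ k ∧
    (m = [i] ∨ m = [i, j] ∨ m = [i, j, k])) := by
  have : ∀ m ∈ words, m = [] ∨ (∃ i j k : Fin 3, (i ≠ j ∧ i ≠ k ∧ j ≠ k) ∧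
    (m = [i] ∨ m = [i, j] ∨ m = [i, j, k])) := by decide +kernel
  simpa only [and_assoc] using this

/-- The development along a word without repetitions is convex. -/
theorem segment_subset_unfolded {F : Face} {m : List (Fin 3)} (hm : m ∈ words) (hne : m ≠ [])
    {g : Face → E3 →ᵃ[ℝ] E2} {c : Fin 3 → E2}
    (hpl : ∀ a ∈ develop F baseTriangle m, ∀ n, g a.1 (a.1.vtx n).pos = latticeMap c (a.2 n))
    {p q : E3} (hp : p ∈ F.carrier) (hq : q ∈ (endFace F m).carrier) :
    segment ℝ (g F p) (g (endFace F m) q) ⊆ unfolded (facePath F m) g := by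
  rintro X ⟨a, b, ha, hb, hab, rfl⟩
  obtain rfl : a = 1 - b := by linarith
  obtain rfl | ⟨i, j, k, hij, hik, hjk, h⟩ := words_cases m hm
  · exact absurd rfl hne
  have hp0 := bary_nonneg p
  have hq0 := bary_nonneg q
  have hp1 := sum_bary hp
  have hq1 := sum_bary hq
  rw [affine_apply _ hp, affine_apply _ hq]
  rw [sum_of_distinct _ hij hik hjk] at hp1 hq1 ⊢
  rw [sum_of_distinct _ hij hik hjk]
  have hpi := hp0 i
  have hpj := hp0 j
  have hpk := hp0 k
  have hqi := hq0 i
  have hqj := hq0 j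
  have hqk := hq0 k
  generalize bary p i = pi at *
  generalize bary p j = pj at *
  generalize bary p k = pk at *
  generalize bary q i = qi at *
  generalize bary q j = qj at *
  generalize bary q k = qk at *
  obtain rfl : pi = 1 - pj - pk := by linarith
  obtain rfl : qi = 1 - qj - qk := by linarith
  have hb1 : 0 ≤ 1 - b := ha
  have m1 := mul_nonneg hb1 hpi
  have m2 := mul_nonneg hb1 hpj
  have m3 := mul_nonneg hb1 hpk
  have m4 := mul_nonneg hb hqi
  have m5 := mul_nonneg hb hqj
  have m6 := mul_nonneg hb hqk
  have unf : ∀ e ∈ develop F baseTriangle m, ∀ X, X ∈ g e.1 '' e.1.carrier →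
      X ∈ unfolded (facePath F m) g := fun e he X hX =>
    Set.mem_biUnion (List.mem_map.2 ⟨e, he, rfl⟩ : e.1 ∈ facePath F m) hX
  have r1 := fun D => latticeMap_reflectCorner_distinct c D hij hik hjk
  have r2 := fun D => latticeMap_reflectCorner_distinct c D hij.symm hjk hik
  have r3 := fun D => latticeMap_reflectCorner_distinct c D hik.symm hjk.symm hij
  rcases h with rfl | rfl | rfl
  · have e0 : (F, baseTriangle) ∈ develop F baseTriangle [i] := by simp [develop]
    have e1 : (F.flip i, reflectCorner baseTriangle i) ∈ develop F baseTriangle [i] := by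
      simp [develop]
    have v0 := hpl _ e0
    have v1 := hpl _ e1
    simp only at v0 v1
    change _ • _ + b • (_ • g (F.flip i) ((F.flip i).vtx i).pos +
      _ • g (F.flip i) ((F.flip i).vtx j).pos + _ • g (F.flip i) ((F.flip i).vtx k).pos) ∈ _
    -- The two summands are the affine coordinates of the point, with origin at corner i and axes
    -- towards corners k and j. The crossed edge is the diagonal on which they sum to 1.
    by_cases c1 : ((1 - b) * pk + b * (1 - qj)) + ((1 - b) * pj + b * (1 - qk)) ≤ 1
    · refine unf _ e0 _ (mem_image_carrier hij hik hjk
        (a := 1 - ((1 - b) * pk + b * (1 - qj)) - ((1 - b) * pj + b * (1 - qk)))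
        (b := (1 - b) * pj + b * (1 - qk)) (c := (1 - b) * pk + b * (1 - qj))
        (by linarith) (by linarith) (by linarith) (by ring) ?_)
      simp only [v0, v1, r1, reflectCorner_of_ne _ hij.symm, reflectCorner_of_ne _ hik.symm]
      module
    · refine unf _ e1 _ (mem_image_carrier hij hik hjk
        (a := ((1 - b) * pk + b * (1 - qj)) + ((1 - b) * pj + b * (1 - qk)) - 1)
        (b := 1 - ((1 - b) * pk + b * (1 - qj))) (c := 1 - ((1 - b) * pj + b * (1 - qk)))
        (by linarith) (by linarith) (by linarith) (by ring) ?_)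
      simp only [v0, v1, r1, reflectCorner_of_ne _ hij.symm, reflectCorner_of_ne _ hik.symm]
      module
  · have e0 : (F, baseTriangle) ∈ develop F baseTriangle [i, j] := by simp [develop]
    have e1 : (F.flip i, reflectCorner baseTriangle i) ∈ develop F baseTriangle [i, j] := by
      simp [develop]
    have e2 : ((F.flip i).flip j, reflectCorner (reflectCorner baseTriangle i) j) ∈
        develop F baseTriangle [i, j] := by simp [develop]
    have v0 := hpl _ e0
    have v1 := hpl _ e1
    have v2 := hpl _ e2
    simp only at v0 v1 v2
    change _ • _ + b • (_ • g ((F.flip i).flip j) (((F.flip i).flip j).vtx i).pos +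
      _ • g ((F.flip i).flip j) (((F.flip i).flip j).vtx j).pos +
      _ • g ((F.flip i).flip j) (((F.flip i).flip j).vtx k).pos) ∈ _
    -- Affine coordinates with origin at corner i, σ towards corner k and τ towards corner j. The
    -- faces form the trapezoid 0 ≤ τ ≤ 1, 0 ≤ σ, σ + τ ≤ 2, cut along the lines σ + τ = 1 and σ =
    -- 1.
    obtain ⟨σ, hσ⟩ : ∃ σ, σ = (1 - b) * pk + b * (1 + qj) := ⟨_, rfl⟩
    obtain ⟨τ, hτ⟩ : ∃ τ, τ = (1 - b) * pj + b * (1 - qj - qk) := ⟨_, rfl⟩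
    by_cases c1 : σ + τ ≤ 1
    · refine unf _ e0 _ (mem_image_carrier hij hik hjk (a := 1 - σ - τ) (b := τ) (c := σ)
        (by linarith) (by linarith) (by linarith) (by ring) ?_)
      simp only [v0, v2, r1, r2, reflectCorner_of_ne _ hij.symm, reflectCorner_of_ne _ hik.symm,
        reflectCorner_of_ne _ hij, reflectCorner_of_ne _ hjk.symm, hσ, hτ]
      module
    by_cases c2 : σ ≤ 1
    · refine unf _ e1 _ (mem_image_carrier hij hik hjk (a := σ + τ - 1) (b := 1 - σ) (c := 1 - τ)
        (by linarith) (by linarith) (by linarith) (by ring) ?_)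
      simp only [v0, v1, v2, r1, r2, reflectCorner_of_ne _ hij.symm, reflectCorner_of_ne _ hik.symm,
        reflectCorner_of_ne _ hij, reflectCorner_of_ne _ hjk.symm, hσ, hτ]
      module
    · refine unf _ e2 _ (mem_image_carrier hij hik hjk (a := τ) (b := σ - 1) (c := 2 - σ - τ)
        (by linarith) (by linarith) (by linarith) (by ring) ?_)
      simp only [v0, v2, r1, r2, reflectCorner_of_ne _ hij.symm, reflectCorner_of_ne _ hik.symm,
        reflectCorner_of_ne _ hij, reflectCorner_of_ne _ hjk.symm, hσ, hτ]
      module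
  · have e0 : (F, baseTriangle) ∈ develop F baseTriangle [i, j, k] := by simp [develop]
    have e1 : (F.flip i, reflectCorner baseTriangle i) ∈ develop F baseTriangle [i, j, k] := by
      simp [develop]
    have e2 : ((F.flip i).flip j, reflectCorner (reflectCorner baseTriangle i) j) ∈
        develop F baseTriangle [i, j, k] := by simp [develop]
    have e3 : (((F.flip i).flip j).flip k,
        reflectCorner (reflectCorner (reflectCorner baseTriangle i) j) k) ∈
        develop F baseTriangle [i, j, k] := by simp [develop]
    have v0 := hpl _ e0
    have v1 := hpl _ e1
    have v2 := hpl _ e2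
    have v3 := hpl _ e3
    simp only at v0 v1 v2 v3
    change _ • _ + b • (_ • g (((F.flip i).flip j).flip k) ((((F.flip i).flip j).flip k).vtx i).pos +
      _ • g (((F.flip i).flip j).flip k) ((((F.flip i).flip j).flip k).vtx j).pos +
      _ • g (((F.flip i).flip j).flip k) ((((F.flip i).flip j).flip k).vtx k).pos) ∈ _
    -- In the same coordinates the four faces form the parallelogram 0 ≤ σ ≤ 2, 0 ≤ τ ≤ 1, cut along
    -- the lines σ + τ = 1, σ = 1 and σ + τ = 2.
    obtain ⟨σ, hσ⟩ : ∃ σ, σ = (1 - b) * pk + b * (1 + qj + qk) := ⟨_, rfl⟩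
    obtain ⟨τ, hτ⟩ : ∃ τ, τ = (1 - b) * pj + b * (1 - qj) := ⟨_, rfl⟩
    by_cases c1 : σ + τ ≤ 1
    · refine unf _ e0 _ (mem_image_carrier hij hik hjk (a := 1 - σ - τ) (b := τ) (c := σ)
        (by linarith) (by linarith) (by linarith) (by ring) ?_)
      simp only [v0, v3, r1, r2, r3, reflectCorner_of_ne _ hij.symm,
        reflectCorner_of_ne _ hik.symm, reflectCorner_of_ne _ hij, reflectCorner_of_ne _ hik,
        reflectCorner_of_ne _ hjk, reflectCorner_of_ne _ hjk.symm, hσ, hτ]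
      module
    by_cases c2 : σ ≤ 1
    · refine unf _ e1 _ (mem_image_carrier hij hik hjk (a := σ + τ - 1) (b := 1 - σ) (c := 1 - τ)
        (by linarith) (by linarith) (by linarith) (by ring) ?_)
      simp only [v0, v1, v3, r1, r2, r3, reflectCorner_of_ne _ hij.symm,
        reflectCorner_of_ne _ hik.symm, reflectCorner_of_ne _ hij, reflectCorner_of_ne _ hik,
        reflectCorner_of_ne _ hjk, reflectCorner_of_ne _ hjk.symm, hσ, hτ]
      module
    by_cases c3 : σ + τ ≤ 2
    · refine unf _ e2 _ (mem_image_carrier hij hik hjk (a := τ) (b := σ - 1) (c := 2 - σ - τ)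
        (by linarith) (by linarith) (by linarith) (by ring) ?_)
      simp only [v0, v2, v3, r1, r2, r3, reflectCorner_of_ne _ hij.symm,
        reflectCorner_of_ne _ hik.symm, reflectCorner_of_ne _ hij, reflectCorner_of_ne _ hik,
        reflectCorner_of_ne _ hjk, reflectCorner_of_ne _ hjk.symm, hσ, hτ]
      module
    · refine unf _ e3 _ (mem_image_carrier hij hik hjk (a := 2 - σ) (b := 1 - τ) (c := σ + τ - 2)
        (by linarith) (by linarith) (by linarith) (by ring) ?_)
      simp only [v0, v3, r1, r2, r3, reflectCorner_of_ne _ hij.symm,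
        reflectCorner_of_ne _ hik.symm, reflectCorner_of_ne _ hij, reflectCorner_of_ne _ hik,
        reflectCorner_of_ne _ hjk, reflectCorner_of_ne _ hjk.symm, hσ, hτ]
      module

/-- The trail length along a word without repetitions is the distance in the development. -/
theorem trailLength_facePath {F : Face} {m : List (Fin 3)} (hm : m ∈ words) (hne : m ≠ [])
    {p q : E3} (hp : p ∈ F.carrier) (hq : q ∈ (endFace F m).carrier) :
    trailLength (facePath F m) p q = ENNReal.ofReal (wordDist m p q) := by
  have copies : ∀ F' G' g, IsOrientation (facePath F m) F' G' g →
      ∃ c : Fin 3 → E2, IsUnitTriangle c ∧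
        (∀ a ∈ develop F baseTriangle m, ∀ n, g a.1 (a.1.vtx n).pos = latticeMap c (a.2 n)) ∧
        (∀ u, IsCopy (facePath F m) g p u → u = ∑ i, bary p i • c i) ∧
        (∀ v, IsCopy (facePath F m) g q v →
          v = ∑ i, bary q i • latticeMap c (endTriangle m i)) := by
    intro F' G' g hg
    have hpl := placed_of_chain (fun i => g F (F.vtx i).pos) g m F baseTriangle hg.2.2.1 hg.2.2.2
      (fun i => (latticeMap_base (fun i => g F (F.vtx i).pos) i).symm)
    -- All copies of a point coincide: a copy in another face has weight only on vertices of K, and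
    -- each vertex has one position.
    have uniq : ∀ {K : Face} {x : E3} {D : Fin 3 → ℤ × ℤ}, x ∈ K.carrier →
        (∀ i, vertexPos F m (K.vtx i) = D i) → ∀ u, IsCopy (facePath F m) g x u →
        u = ∑ i, bary x i • latticeMap (fun i => g F (F.vtx i).pos) (D i) := by
      rintro K x D hxK hD u ⟨H, hH, hx, rfl⟩
      obtain ⟨a, ha, rfl⟩ := List.mem_map.1 hH
      rw [affine_apply _ hx]
      refine Finset.sum_congr rfl fun i _ => ?_
      by_cases e : a.1.vtx i = K.vtx i
      · rw [hpl a ha, vertexPos_develop F m hm a ha, e, hD]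
      · rw [bary_eq_zero hx hxK e, zero_smul, zero_smul]
    refine ⟨_, (hg.2.2.1 F (start_mem_facePath F m)).isUnitTriangle, hpl, fun u hu => ?_,
      uniq hq (vertexPos_end F m hm)⟩
    have := uniq hp (vertexPos_start F m) u hu
    simpa only [latticeMap_base] using this
  refine le_antisymm ?_ ?_
  · obtain ⟨F', G', g, hg⟩ := exists_isOrientation F hm
    obtain ⟨c, hc, hpl, hu, hv⟩ := copies F' G' g hg
    have cu : IsCopy (facePath F m) g p (g F p) := ⟨F, start_mem_facePath F m, hp, rfl⟩
    have cv : IsCopy (facePath F m) g q (g (endFace F m) q) :=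
      ⟨_, end_mem_facePath F m hm, hq, rfl⟩
    have h : edist (g F p) (g (endFace F m) q) = ENNReal.ofReal (wordDist m p q) := by
      rw [edist_dist, hu _ cu, hv _ cv, dist_develop hc m hp hq]
    rw [← h]
    exact iInf_le_of_le F' (iInf_le_of_le G' (iInf_le_of_le g (iInf_le_of_le hg
      (iInf_le_of_le _ (iInf_le_of_le cu (iInf_le_of_le _ (iInf_le_of_le cv
        (iInf_le _ (segment_subset_unfolded hm hne hpl hp hq)))))))))
  · unfold trailLength
    simp only [le_iInf_iff]
    intro F' G' g hg u hu v hv _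
    obtain ⟨c, hc, _, hu', hv'⟩ := copies F' G' g hg
    rw [edist_dist, hu' u hu, hv' v hv, dist_develop hc m hp hq]

/-! ### The surface distance -/

/-- Prepending a vertex adds an edge to a vertex isolated so far, which cannot close a cycle. The
support condition in the conclusion is what keeps the new vertex isolated. -/
theorem exists_acyclic_of_chain {V : Type*} {G : SimpleGraph V} (L : List V) (hnd : L.Nodup)
    (hch : L.IsChain G.Adj) :
    ∃ N ≤ G, N.IsAcyclic ∧ L.IsChain N.Adj ∧ ∀ u v, N.Adj u v → u ∈ L := by
  induction L with
  | nil => exact ⟨⊥, bot_le, SimpleGraph.isAcyclic_bot, List.isChain_nil, by simp⟩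
  | cons a L ih =>
    obtain ⟨N, hN, hac, hNch, hsup⟩ := ih hnd.of_cons hch.tail
    cases L with
    | nil => exact ⟨⊥, bot_le, SimpleGraph.isAcyclic_bot, by simp, by simp⟩
    | cons b L =>
      rw [List.isChain_cons_cons] at hch
      have ha : a ∉ b :: L := (List.nodup_cons.1 hnd).1
      have hab : a ≠ b := hch.1.ne
      have hnr : ¬ N.Reachable a b := by
        rintro ⟨w⟩
        cases w with
        | nil => exact hab rfl
        | cons h _ => exact ha (hsup _ _ h)
      have hadj : (N ⊔ SimpleGraph.edge a b).Adj a b := by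
        simp [SimpleGraph.edge_adj, hab]
      refine ⟨N ⊔ SimpleGraph.edge a b, ?_, hac.sup_edge_of_not_reachable hnr, ?_, ?_⟩
      · refine sup_le hN fun u v h => ?_
        rw [SimpleGraph.edge_adj] at h
        rcases h.1 with ⟨rfl, rfl⟩ | ⟨rfl, rfl⟩
        exacts [hch.1, hch.1.symm]
      · rw [List.isChain_cons_cons]
        exact ⟨hadj, hNch.imp fun _ _ h => Or.inl h⟩
      · intro u v h
        rcases h with h | h
        · exact List.mem_cons_of_mem _ (hsup u v h)
        · rw [SimpleGraph.edge_adj] at h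
          rcases h.1 with ⟨rfl, rfl⟩ | ⟨rfl, rfl⟩ <;> simp

theorem faceGraph_connected : faceGraph.Connected := by
  have h : ∀ G : Face, ∀ m ∈ wordsTo F1 G, faceGraph.Reachable F1 G := by
    intro G m hm
    obtain ⟨-, rfl⟩ := mem_wordsTo.1 hm
    rw [endFace]
    generalize F1 = F
    clear hm
    induction m generalizing F with
    | nil => exact SimpleGraph.Reachable.refl _
    | cons i m ih => exact (adj_flip F i).reachable.trans (ih (F.flip i))
  have h' : ∀ G, faceGraph.Reachable F1 G := fun G => (wordsTo_nonempty F1 G).elim fun m hm => h G m hm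
  have : Nonempty Face := ⟨F1⟩
  exact ⟨fun G H => (h' G).symm.trans (h' H)⟩

theorem isLandscape_facePath (F : Face) {m : List (Fin 3)} (hm : m ∈ words) (hne : m ≠ []) :
    IsLandscape (facePath F m) := by
  obtain ⟨N, hN, hac, hch, _⟩ := exists_acyclic_of_chain _ (facePath_nodup F m hm)
    (isChain_develop adj_flip m F baseTriangle)
  obtain ⟨T, hNT, hT, htree⟩ := faceGraph_connected.exists_isTree_le_of_le_of_isAcyclic hN hac
  refine ⟨?_, facePath_nodup F m hm, T, ⟨hT, htree⟩, hch.imp fun _ _ h => hNT h⟩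
  rw [facePath, List.length_map, length_develop]
  have := List.length_pos_iff.2 hne
  omega

/-- The surface distance is attained on a word without repetitions. -/
theorem surfaceDist_eq {F G : Face} (hFG : F ≠ G) {p q : E3} (hp : p ∈ F.carrier)
    (hq : q ∈ G.carrier) :
    surfaceDist p q = (wordsTo F G).inf fun m => trailLength (facePath F m) p q := by
  have hne : ∀ m ∈ wordsTo F G, m ∈ words ∧ m ≠ [] ∧ endFace F m = G := by
    intro m hm
    obtain ⟨h1, h2⟩ := mem_wordsTo.1 hm
    refine ⟨h1, ?_, h2⟩
    rintro rfl
    exact hFG h2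
  refine le_antisymm (Finset.le_inf fun m hm => ?_) ?_
  · exact iInf₂_le _ (isLandscape_facePath F (hne m hm).1 (hne m hm).2.1)
  · refine le_trans ?_ (ofReal_faceDist_le_surfaceDist hp hq)
    obtain ⟨m, hm, e⟩ := Finset.exists_mem_eq_inf' (wordsTo_nonempty F G) fun m => wordDist m p q
    obtain ⟨h1, h2, h3⟩ := hne m hm
    subst h3
    rw [faceDist, e, ← trailLength_facePath h1 h2 hp hq]
    exact Finset.inf_le hm

/-! ### Labellings -/

theorem opposite_iff (F G : Face) : Opposite F G ↔ G = F.co := by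
  unfold Opposite; revert F G; decide +kernel

theorem exists_cyclic (F : Face) (i : Fin 3) : ∃ j k, F.Cyclic i k j := by
  unfold Face.Cyclic permSign
  simp only [Matrix.det_fin_three]
  revert F i; decide +kernel

/-- A flip reverses chirality. This decides which base corner of the second face sits at the origin
of its chart. -/
theorem cyclic_flip {F : Face} {i j k : Fin 3} (n : Fin 3) (h : F.Cyclic i k j) :
    (F.flip n).Cyclic i j k := by
  unfold Face.Cyclic permSign at *
  simp only [Matrix.det_fin_three] at *
  revert F i j k n; decide +kernel

theorem flip_comm (F : Face) (i j : Fin 3) : (F.flip i).flip j = (F.flip j).flip i := by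
  revert F i j; decide +kernel

theorem exists_flip_flip {F G : Face} (hne : F ≠ G) (hadj : ¬ faceGraph.Adj F G)
    (hopp : ¬ Opposite F G) : ∃ i j k, F.Cyclic i k j ∧ G = (F.flip i).flip k := by
  rw [opposite_iff] at hopp
  unfold Face.Cyclic permSign
  simp only [Matrix.det_fin_three]
  revert F G; decide +kernel

theorem cyclic_co {F : Face} {i j k : Fin 3} (h : F.Cyclic i k j) : F.co.Cyclic i j k := by
  unfold Face.Cyclic permSign at *
  simp only [Matrix.det_fin_three] at *
  revert F i j k; decide +kernel

theorem flip_flip (F : Face) (i : Fin 3) : (F.flip i).flip i = F := by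
  revert F i; decide +kernel

theorem co_flip (F : Face) {i j k : Fin 3} (hij : i ≠ j) (hik : i ≠ k) (hjk : j ≠ k) :
    F.co.flip i = (F.flip j).flip k := by
  revert F i j k; decide +kernel

theorem co_of_flip (F : Face) (i : Fin 3) : (F.flip i).co = F.co.flip i := by
  revert F i; decide +kernel

/-- The neighbour across axis i lies opposite corner i, so neighbours turn around F in the same
sense as the corners; clockwise i, j, k is counterclockwise i, k, j. -/
theorem clockwise_iff (F : Face) (i j k : Fin 3) :
    ClockwiseAround F (F.flip i) (F.flip j) (F.flip k) ↔ F.Cyclic i k j := by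
  unfold ClockwiseAround Face.Cyclic permSign
  simp only [Matrix.det_fin_three, adj_flip, true_and]
  revert F i j k; decide +kernel

/-- The faces of a labelling in terms of its first face and the axes of its neighbours. -/
structure IsFraming (ν : Face → Face) (F : Face) (i j k : Fin 3) : Prop where
  cyclic : F.Cyclic i k j
  eq1 : ν F1 = F
  eq2 : ν F2 = F.flip i
  eq3 : ν F3 = (F.flip i).flip j
  eq4 : ν F4 = F.flip j
  eq5 : ν F5 = (F.flip i).flip k
  eq6 : ν F6 = F.flip k
  eq7 : ν F7 = (F.flip j).flip k
  eq8 : ν F8 = F.co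

/-- The four faces around the first one are fixed by the axes, and the opposite-face condition
determines the rest: the antipode of a neighbour across one axis differs from F in the other two
signs. -/
theorem IsLabelling.exists_isFraming {ν : Face → Face} (h : IsLabelling ν) :
    ∃ i j k, IsFraming ν (ν F1) i j k := by
  obtain ⟨_, hopp, hcw⟩ := h
  obtain ⟨i, hi⟩ := (adj_iff_flip _ _).1 hcw.1
  obtain ⟨j, hj⟩ := (adj_iff_flip _ _).1 hcw.2.1
  obtain ⟨k, hk⟩ := (adj_iff_flip _ _).1 hcw.2.2.1
  rw [hi, hj, hk, clockwise_iff] at hcw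
  obtain ⟨hik, hij, hkj⟩ := hcw.distinct
  have co : ∀ a, ν a.co = (ν a).co := fun a => (opposite_iff _ _).1 (hopp a)
  refine ⟨i, j, k, hcw, rfl, hi, ?_, hj, ?_, hk, ?_, co F1⟩
  · rw [← co_flip _ hik.symm hkj hij, ← co_of_flip, ← hk]; exact co F6
  · rw [← co_flip _ hij.symm hkj.symm hik, ← co_of_flip, ← hj]; exact co F4
  · rw [← co_flip _ hij hik hkj.symm, ← co_of_flip, ← hi]; exact co F2

/-- The labelling with a given first face and given axes of its neighbours. -/
def labelling (F : Face) (i j k : Fin 3) : Face → Face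
  | F1 => F
  | F2 => F.flip i
  | F3 => (F.flip i).flip j
  | F4 => F.flip j
  | F5 => (F.flip i).flip k
  | F6 => F.flip k
  | F7 => (F.flip j).flip k
  | F8 => F.co

theorem isLabelling_labelling {F : Face} {i j k : Fin 3} (h : F.Cyclic i k j) :
    IsLabelling (labelling F i j k) := by
  obtain ⟨hik, hij, hkj⟩ := h.distinct
  refine ⟨Finite.injective_iff_bijective.1 ?_, fun a => ?_, (clockwise_iff F i j k).2 h⟩
  · clear h
    revert F i j k; unfold Function.Injective; decide +kernel
  · rw [opposite_iff]
    clear h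
    revert F i j k a; decide +kernel

/-- The words of the landscapes `L₁, …, L₉`. -/
def labelWord (i j k : Fin 3) : ℕ → List (Fin 3)
  | 1 => [i]
  | 2 => [i, k]
  | 3 => [k, i]
  | 4 => [k, i, j]
  | 5 => [i, j, k]
  | 6 => [j, k, i]
  | 7 => [k, j, i]
  | 8 => [i, k, j]
  | 9 => [j, i, k]
  | _ => []

theorem IsFraming.land_eq {ν : Face → Face} {F : Face} {i j k : Fin 3} (h : IsFraming ν F i j k)
    {a : ℕ} (ha : a ∈ Finset.Icc 1 9) : land ν a = facePath F (labelWord i j k a) := by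
  obtain ⟨hik, hij, hkj⟩ := h.cyclic.distinct
  obtain ⟨h1, h2⟩ := Finset.mem_Icc.1 ha
  interval_cases a <;>
    simp only [land, labelWord, facePath, develop, List.map_cons, List.map_nil, h.eq1, h.eq2, h.eq3,
      h.eq4, h.eq5, h.eq6, h.eq7, h.eq8, List.cons.injEq, true_and, and_true]
  all_goals clear h ha h1 h2; revert F i j k; decide +kernel

theorem labelWord_mem {i j k : Fin 3} (hij : i ≠ j) (hik : i ≠ k) (hjk : j ≠ k) {a : ℕ}
    (ha : a ∈ Finset.Icc 1 9) : labelWord i j k a ∈ words ∧ labelWord i j k a ≠ [] := by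
  obtain ⟨h1, h2⟩ := Finset.mem_Icc.1 ha
  clear ha
  interval_cases a <;> clear h1 h2 <;> revert i j k <;> decide +kernel

theorem wordsTo_flip (F : Face) (i j k : Fin 3) :
    wordsTo F (F.flip i) = ({1} : Finset ℕ).image (labelWord i j k) := by
  revert F i j k; decide +kernel

theorem wordsTo_flip_flip (F : Face) {i j k : Fin 3} (hij : i ≠ j) (hik : i ≠ k) (hjk : j ≠ k) :
    wordsTo F ((F.flip i).flip k) = ({2, 3} : Finset ℕ).image (labelWord i j k) := by
  revert F i j k; decide +kernel

/-- Reaching the antipode requires all three flips, and the six orders of the axes are exactly the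
words of the last six landscapes. -/
theorem wordsTo_co (F : Face) {i j k : Fin 3} (hij : i ≠ j) (hik : i ≠ k) (hjk : j ≠ k) :
    wordsTo F F.co = (Finset.Icc 4 9).image (labelWord i j k) := by
  revert F i j k; decide +kernel

/-! ### The coordinate formulas -/

theorem mixedSq_eq (d : Fin 3 → Fin 3 → ℝ) (w t : Fin 3 → ℝ) {i j k : Fin 3} (hij : i ≠ j)
    (hik : i ≠ k) (hjk : j ≠ k) : mixedSq d w t =
      w i * t i * d i i + w i * t j * d i j + w i * t k * d i k +
      w j * t i * d j i + w j * t j * d j j + w j * t k * d j k +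
      w k * t i * d k i + w k * t j * d k j + w k * t k * d k k
      - (w i * w j + w i * w k + w j * w k) - (t i * t j + t i * t k + t j * t k) := by
  have hperm : ∀ w : Fin 3 → ℝ, w 0 * w 1 + w 0 * w 2 + w 1 * w 2 =
      w i * w j + w i * w k + w j * w k := by
    intro w
    fin_cases i <;> fin_cases j <;> fin_cases k <;>
      first | exact absurd rfl hij | exact absurd rfl hik | exact absurd rfl hjk | (simp; try ring)
  rw [mixedSq, hperm, hperm]
  simp only [sum_of_distinct _ hij hik hjk]
  ring

theorem cornerSq_one {i j k : Fin 3} (hij : i ≠ j) (hik : i ≠ k) (hjk : j ≠ k) :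
    cornerSq [i] i i = 3 ∧ cornerSq [i] i j = 1 ∧ cornerSq [i] i k = 1 ∧
    cornerSq [i] j i = 1 ∧ cornerSq [i] j j = 0 ∧ cornerSq [i] j k = 1 ∧
    cornerSq [i] k i = 1 ∧ cornerSq [i] k j = 1 ∧ cornerSq [i] k k = 0 := by
  revert i j k; decide +kernel

theorem cornerSq_two {i j k : Fin 3} (hij : i ≠ j) (hik : i ≠ k) (hjk : j ≠ k) :
    cornerSq [i, j] i i = 3 ∧ cornerSq [i, j] i j = 4 ∧ cornerSq [i, j] i k = 1 ∧
    cornerSq [i, j] j i = 1 ∧ cornerSq [i, j] j j = 3 ∧ cornerSq [i, j] j k = 1 ∧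
    cornerSq [i, j] k i = 1 ∧ cornerSq [i, j] k j = 1 ∧ cornerSq [i, j] k k = 0 := by
  revert i j k; decide +kernel

theorem cornerSq_three {i j k : Fin 3} (hij : i ≠ j) (hik : i ≠ k) (hjk : j ≠ k) :
    cornerSq [i, j, k] i i = 3 ∧ cornerSq [i, j, k] i j = 4 ∧ cornerSq [i, j, k] i k = 7 ∧
    cornerSq [i, j, k] j i = 1 ∧ cornerSq [i, j, k] j j = 3 ∧ cornerSq [i, j, k] j k = 4 ∧
    cornerSq [i, j, k] k i = 1 ∧ cornerSq [i, j, k] k j = 1 ∧ cornerSq [i, j, k] k k = 3 := by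
  revert i j k; decide +kernel

theorem wordDist_sq_one {F G : Face} {p q : E3} (hp : p ∈ F.carrier) (hq : q ∈ G.carrier)
    {i j k : Fin 3} (hij : i ≠ j) (hik : i ≠ k) (hjk : j ≠ k) : wordDist [i] p q ^ 2 =
      3 * (bary p i * bary q i) + bary p i * bary q j + bary p i * bary q k + bary p j * bary q i
      + bary p j * bary q k + bary p k * bary q i + bary p k * bary q j
      - (bary p i * bary p j + bary p i * bary p k + bary p j * bary p k)
      - (bary q i * bary q j + bary q i * bary q k + bary q j * bary q k) := by
  rw [wordDist_sq _ hp hq, mixedSq_eq _ _ _ hij hik hjk]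
  obtain ⟨h1, h2, h3, h4, h5, h6, h7, h8, h9⟩ := cornerSq_one hij hik hjk
  simp only [h1, h2, h3, h4, h5, h6, h7, h8, h9]
  push_cast
  ring

theorem wordDist_sq_two {F G : Face} {p q : E3} (hp : p ∈ F.carrier) (hq : q ∈ G.carrier)
    {i j k : Fin 3} (hij : i ≠ j) (hik : i ≠ k) (hjk : j ≠ k) : wordDist [i, j] p q ^ 2 =
      3 * (bary p i * bary q i) + 4 * (bary p i * bary q j) + bary p i * bary q k
      + bary p j * bary q i + 3 * (bary p j * bary q j) + bary p j * bary q k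
      + bary p k * bary q i + bary p k * bary q j
      - (bary p i * bary p j + bary p i * bary p k + bary p j * bary p k)
      - (bary q i * bary q j + bary q i * bary q k + bary q j * bary q k) := by
  rw [wordDist_sq _ hp hq, mixedSq_eq _ _ _ hij hik hjk]
  obtain ⟨h1, h2, h3, h4, h5, h6, h7, h8, h9⟩ := cornerSq_two hij hik hjk
  simp only [h1, h2, h3, h4, h5, h6, h7, h8, h9]
  push_cast
  ring

theorem wordDist_sq_three {F G : Face} {p q : E3} (hp : p ∈ F.carrier) (hq : q ∈ G.carrier)
    {i j k : Fin 3} (hij : i ≠ j) (hik : i ≠ k) (hjk : j ≠ k) : wordDist [i, j, k] p q ^ 2 =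
      3 * (bary p i * bary q i) + 4 * (bary p i * bary q j) + 7 * (bary p i * bary q k)
      + bary p j * bary q i + 3 * (bary p j * bary q j) + 4 * (bary p j * bary q k)
      + bary p k * bary q i + bary p k * bary q j + 3 * (bary p k * bary q k)
      - (bary p i * bary p j + bary p i * bary p k + bary p j * bary p k)
      - (bary q i * bary q j + bary q i * bary q k + bary q j * bary q k) := by
  rw [wordDist_sq _ hp hq, mixedSq_eq _ _ _ hij hik hjk]
  obtain ⟨h1, h2, h3, h4, h5, h6, h7, h8, h9⟩ := cornerSq_three hij hik hjk
  simp only [h1, h2, h3, h4, h5, h6, h7, h8, h9]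
  push_cast
  ring

theorem sqrt_eq_wordDist {m : List (Fin 3)} {p q : E3} {r : ℝ} (h : wordDist m p q ^ 2 = r) :
    √r = wordDist m p q := by
  rw [← h, Real.sqrt_sq (wordDist_nonneg _ _ _)]

/-- The arguments are chart coordinates. For p, corner k is at the origin and j at (1, 0); one flip
reverses orientation, so for q these roles are exchanged. They are also exchanged after three flips,
but not after two. -/
theorem trailFormula_one {F G : Face} {p q : E3} (hp : p ∈ F.carrier) (hq : q ∈ G.carrier)
    {i j k : Fin 3} (hij : i ≠ j) (hik : i ≠ k) (hjk : j ≠ k) :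
    trailFormula (bary p j + bary p i / 2) (√3 / 2 * bary p i) (bary q k + bary q i / 2)
      (√3 / 2 * bary q i) 1 = wordDist (labelWord i j k 1) p q := by
  refine sqrt_eq_wordDist ?_
  have hp1 := sum_bary hp
  have hq1 := sum_bary hq
  have h3 := sqrt_three_sq
  rw [sum_of_distinct _ hij hik hjk] at hp1 hq1
  simp only [labelWord]
  rw [wordDist_sq_one hp hq hij hik hjk]
  have hpk : bary p k = 1 - bary p i - bary p j := by linarith
  have hqk : bary q k = 1 - bary q i - bary q j := by linarith
  rw [hpk, hqk]
  grind

theorem trailFormula_two {F G : Face} {p q : E3} (hp : p ∈ F.carrier) (hq : q ∈ G.carrier)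
    {i j k : Fin 3} (hij : i ≠ j) (hik : i ≠ k) (hjk : j ≠ k) {a : ℕ}
    (ha : a ∈ ({2, 3} : Finset ℕ)) :
    trailFormula (bary p j + bary p i / 2) (√3 / 2 * bary p i) (bary q j + bary q i / 2)
      (√3 / 2 * bary q i) a = wordDist (labelWord i j k a) p q := by
  have hp1 := sum_bary hp
  have hq1 := sum_bary hq
  have h3 := sqrt_three_sq
  rw [sum_of_distinct _ hij hik hjk] at hp1 hq1
  have hpk : bary p k = 1 - bary p i - bary p j := by linarith
  have hqk : bary q k = 1 - bary q i - bary q j := by linarith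
  simp only [Finset.mem_insert, Finset.mem_singleton] at ha
  rcases ha with rfl | rfl <;> refine sqrt_eq_wordDist ?_ <;> simp only [labelWord]
  · rw [wordDist_sq_two hp hq hik hij hjk.symm, hpk, hqk]
    grind
  · rw [wordDist_sq_two hp hq hik.symm hjk.symm hij, hpk, hqk]
    grind

theorem trailFormula_three {F G : Face} {p q : E3} (hp : p ∈ F.carrier) (hq : q ∈ G.carrier)
    {i j k : Fin 3} (hij : i ≠ j) (hik : i ≠ k) (hjk : j ≠ k) {a : ℕ}
    (ha : a ∈ Finset.Icc 4 9) :
    trailFormula (bary p j + bary p i / 2) (√3 / 2 * bary p i) (bary q k + bary q i / 2)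
      (√3 / 2 * bary q i) a = wordDist (labelWord i j k a) p q := by
  have hp1 := sum_bary hp
  have hq1 := sum_bary hq
  have h3 := sqrt_three_sq
  rw [sum_of_distinct _ hij hik hjk] at hp1 hq1
  have hpk : bary p k = 1 - bary p i - bary p j := by linarith
  have hqk : bary q k = 1 - bary q i - bary q j := by linarith
  obtain ⟨h1, h2⟩ := Finset.mem_Icc.1 ha
  interval_cases a <;> refine sqrt_eq_wordDist ?_ <;> simp only [labelWord]
  · rw [wordDist_sq_three hp hq hik.symm hjk.symm hij, hpk, hqk]
    grind
  · rw [wordDist_sq_three hp hq hij hik hjk, hpk, hqk]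
    grind
  · rw [wordDist_sq_three hp hq hjk hij.symm hik.symm, hpk, hqk]
    grind
  · rw [wordDist_sq_three hp hq hjk.symm hik.symm hij.symm, hpk, hqk]
    grind
  · rw [wordDist_sq_three hp hq hik hij hjk.symm, hpk, hqk]
    grind
  · rw [wordDist_sq_three hp hq hij.symm hjk hik, hpk, hqk]
    grind

theorem trailLength_land {ν : Face → Face} {F : Face} {i j k : Fin 3} (h : IsFraming ν F i j k)
    {a : ℕ} (ha : a ∈ Finset.Icc 1 9) {p q : E3} (hp : p ∈ F.carrier)
    (hq : q ∈ (endFace F (labelWord i j k a)).carrier) :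
    trailLength (land ν a) p q = ENNReal.ofReal (wordDist (labelWord i j k a) p q) := by
  obtain ⟨hik, hij, hkj⟩ := h.cyclic.distinct
  obtain ⟨h1, h2⟩ := labelWord_mem hij hik hkj.symm ha
  rw [h.land_eq ha, trailLength_facePath h1 h2 hp hq]

theorem surfaceDist_eq_inf_land {ν : Face → Face} {F G : Face} {i j k : Fin 3}
    (h : IsFraming ν F i j k) (hFG : F ≠ G) {S : Finset ℕ} (hS : S ⊆ Finset.Icc 1 9)
    (hw : wordsTo F G = S.image (labelWord i j k)) {p q : E3} (hp : p ∈ F.carrier)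
    (hq : q ∈ G.carrier) :
    surfaceDist p q = S.inf fun a => trailLength (land ν a) p q := by
  rw [surfaceDist_eq hFG hp hq, hw, Finset.inf_image]
  exact Finset.inf_congr rfl fun a ha => by rw [h.land_eq (hS ha)]; rfl

end Octahedron

end

/-! ### The three relative positions of two faces -/

theorem mainTheorem3 (p₁ p₂ : Octahedron.E3) (F G : Octahedron.Face)
    (hFG : F ≠ G) (h₁ : p₁ ∈ F.carrier) (h₂ : p₂ ∈ G.carrier) (hne : p₁ ≠ p₂) :
    (Octahedron.faceGraph.Adj F G →
      (∃ (ν : Octahedron.Face → Octahedron.Face) (x₁ y₁ x₂ y₂ : ℝ),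
        Octahedron.Normalized p₁ p₂ F G .F1 .F2 .F2 .F1 ν x₁ y₁ x₂ y₂) ∧
      ∀ (ν : Octahedron.Face → Octahedron.Face) (x₁ y₁ x₂ y₂ : ℝ),
        Octahedron.Normalized p₁ p₂ F G .F1 .F2 .F2 .F1 ν x₁ y₁ x₂ y₂ →
        Octahedron.trailLength (Octahedron.land ν 1) p₁ p₂ =
            ENNReal.ofReal (Octahedron.trailFormula x₁ y₁ x₂ y₂ 1) ∧
        Octahedron.surfaceDist p₁ p₂ = Octahedron.trailLength (Octahedron.land ν 1) p₁ p₂) ∧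
    (¬ Octahedron.faceGraph.Adj F G → ¬ Octahedron.Opposite F G →
      (∃ (ν : Octahedron.Face → Octahedron.Face) (x₁ y₁ x₂ y₂ : ℝ),
        Octahedron.Normalized p₁ p₂ F G .F1 .F2 .F5 .F6 ν x₁ y₁ x₂ y₂) ∧
      ∀ (ν : Octahedron.Face → Octahedron.Face) (x₁ y₁ x₂ y₂ : ℝ),
        Octahedron.Normalized p₁ p₂ F G .F1 .F2 .F5 .F6 ν x₁ y₁ x₂ y₂ →
        (∀ a ∈ ({2, 3} : Finset ℕ), Octahedron.trailLength (Octahedron.land ν a) p₁ p₂ =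
            ENNReal.ofReal (Octahedron.trailFormula x₁ y₁ x₂ y₂ a)) ∧
        Octahedron.surfaceDist p₁ p₂ =
          min (Octahedron.trailLength (Octahedron.land ν 2) p₁ p₂)
            (Octahedron.trailLength (Octahedron.land ν 3) p₁ p₂)) ∧
    (Octahedron.Opposite F G →
      (∃ (ν : Octahedron.Face → Octahedron.Face) (x₁ y₁ x₂ y₂ : ℝ),
        Octahedron.Normalized p₁ p₂ F G .F1 .F2 .F8 .F7 ν x₁ y₁ x₂ y₂) ∧
      ∀ (ν : Octahedron.Face → Octahedron.Face) (x₁ y₁ x₂ y₂ : ℝ),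
        Octahedron.Normalized p₁ p₂ F G .F1 .F2 .F8 .F7 ν x₁ y₁ x₂ y₂ →
        (∀ a ∈ Finset.Icc 4 9, Octahedron.trailLength (Octahedron.land ν a) p₁ p₂ =
            ENNReal.ofReal (Octahedron.trailFormula x₁ y₁ x₂ y₂ a)) ∧
        Octahedron.surfaceDist p₁ p₂ =
          (Finset.Icc 4 9).inf
            (fun a => Octahedron.trailLength (Octahedron.land ν a) p₁ p₂)) := by
  refine ⟨fun hadj => ?_, fun hadj hopp => ?_, fun hopp => ?_⟩
  · obtain ⟨i, rfl⟩ := (Octahedron.adj_iff_flip F G).1 hadj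
    refine ⟨?_, ?_⟩
    · obtain ⟨j, k, h⟩ := Octahedron.exists_cyclic F i
      obtain ⟨x₁, y₁, hr₁⟩ := Octahedron.exists_isRep h h₁
      obtain ⟨x₂, y₂, hr₂⟩ := Octahedron.exists_isRep (Octahedron.cyclic_flip i h) h₂
      rw [Octahedron.flip_flip] at hr₂
      exact ⟨_, x₁, y₁, x₂, y₂, Octahedron.isLabelling_labelling h, rfl, rfl, hr₁, hr₂⟩
    · rintro ν x₁ y₁ x₂ y₂ ⟨hν, hF, hG, hr₁, hr₂⟩
      obtain ⟨i', j, k, h⟩ := hν.exists_isFraming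
      rw [hF] at h hr₁ hr₂
      obtain ⟨hik, hij, hkj⟩ := h.cyclic.distinct
      rw [h.eq2] at hG hr₁ hr₂
      rw [← hG] at h₂ hFG
      obtain ⟨rfl, rfl⟩ := hr₁.coords h.cyclic
      have h' := Octahedron.cyclic_flip i' h.cyclic
      -- The chart of the second point uses the edge shared with F, which must be written as a flip
      -- of the second face across the same axis.
      nth_rw 2 [← Octahedron.flip_flip F i'] at hr₂
      obtain ⟨rfl, rfl⟩ := hr₂.coords h'
      refine ⟨?_, ?_⟩
      · rw [Octahedron.trailLength_land (a := 1) h (by decide) h₁ h₂,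
          Octahedron.trailFormula_one h₁ h₂ hij hik hkj.symm]
      · rw [Octahedron.surfaceDist_eq_inf_land h hFG (by decide)
          (Octahedron.wordsTo_flip F i' j k) h₁ h₂, Finset.inf_singleton]
  · obtain ⟨i, j, k, h, rfl⟩ := Octahedron.exists_flip_flip hFG hadj hopp
    refine ⟨?_, ?_⟩
    · obtain ⟨x₁, y₁, hr₁⟩ := Octahedron.exists_isRep h h₁
      have h' := Octahedron.cyclic_flip k (Octahedron.cyclic_flip i h)
      obtain ⟨x₂, y₂, hr₂⟩ := Octahedron.exists_isRep h' h₂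
      have e : ((F.flip i).flip k).flip i = F.flip k := by
        rw [Octahedron.flip_comm F, Octahedron.flip_flip]
      rw [e] at hr₂
      exact ⟨_, x₁, y₁, x₂, y₂, Octahedron.isLabelling_labelling h, rfl, rfl, hr₁, hr₂⟩
    · rintro ν x₁ y₁ x₂ y₂ ⟨hν, hF, hG, hr₁, hr₂⟩
      obtain ⟨i', j', k', h⟩ := hν.exists_isFraming
      rw [hF] at h hr₁
      obtain ⟨hik, hij, hkj⟩ := h.cyclic.distinct
      rw [h.eq2] at hr₁
      rw [h.eq5] at hG hr₂
      rw [h.eq6] at hr₂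
      rw [← hG] at h₂ hFG
      obtain ⟨rfl, rfl⟩ := hr₁.coords h.cyclic
      have h' := Octahedron.cyclic_flip k' (Octahedron.cyclic_flip i' h.cyclic)
      have e : F.flip k' = ((F.flip i').flip k').flip i' := by
        rw [Octahedron.flip_comm F, Octahedron.flip_flip]
      rw [e] at hr₂
      obtain ⟨rfl, rfl⟩ := hr₂.coords h'
      refine ⟨fun a ha => ?_, ?_⟩
      · have hw := Finset.mem_image_of_mem (Octahedron.labelWord i' j' k') ha
        -- Membership in the candidate set supplies the fact that the word of the landscape ends at
        -- the face of the second point.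
        rw [← Octahedron.wordsTo_flip_flip F hij hik hkj.symm, Octahedron.mem_wordsTo] at hw
        rw [Octahedron.trailLength_land h (Finset.mem_of_subset (by decide) ha) h₁
          (hw.2 ▸ h₂), Octahedron.trailFormula_two h₁ h₂ hij hik hkj.symm ha]
      · rw [Octahedron.surfaceDist_eq_inf_land h hFG (by decide)
          (Octahedron.wordsTo_flip_flip F hij hik hkj.symm) h₁ h₂, Finset.inf_insert,
          Finset.inf_singleton]
  · obtain rfl := (Octahedron.opposite_iff F G).1 hopp
    refine ⟨?_, ?_⟩
    · obtain ⟨j, k, h⟩ := Octahedron.exists_cyclic F 0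
      obtain ⟨hik, hij, hkj⟩ := h.distinct
      obtain ⟨x₁, y₁, hr₁⟩ := Octahedron.exists_isRep h h₁
      have h' := Octahedron.cyclic_co h
      obtain ⟨x₂, y₂, hr₂⟩ := Octahedron.exists_isRep h' h₂
      rw [Octahedron.co_flip F hij hik hkj.symm] at hr₂
      exact ⟨_, x₁, y₁, x₂, y₂, Octahedron.isLabelling_labelling h, rfl, rfl, hr₁, hr₂⟩
    · rintro ν x₁ y₁ x₂ y₂ ⟨hν, hF, hG, hr₁, hr₂⟩
      obtain ⟨i, j, k, h⟩ := hν.exists_isFraming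
      rw [hF] at h hr₁
      obtain ⟨hik, hij, hkj⟩ := h.cyclic.distinct
      rw [h.eq2] at hr₁
      rw [h.eq8, h.eq7, ← Octahedron.co_flip F hij hik hkj.symm] at hr₂
      obtain ⟨rfl, rfl⟩ := hr₁.coords h.cyclic
      obtain ⟨rfl, rfl⟩ := hr₂.coords (Octahedron.cyclic_co h.cyclic)
      refine ⟨fun a ha => ?_, ?_⟩
      · have hw := Finset.mem_image_of_mem (Octahedron.labelWord i j k) ha
        rw [← Octahedron.wordsTo_co F hij hik hkj.symm, Octahedron.mem_wordsTo] at hw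
        rw [Octahedron.trailLength_land h (Finset.mem_of_subset (by decide) ha) h₁
          (hw.2 ▸ h₂), Octahedron.trailFormula_three h₁ h₂ hij hik hkj.symm ha]
      · exact Octahedron.surfaceDist_eq_inf_land h hFG (by decide)
          (Octahedron.wordsTo_co F hij hik hkj.symm) h₁ h₂
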